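/- Let $\mathfrak X$ be a connected smooth Riemannian manifold (Hausdorff, second countable, without boundary) of dimension $n\ge 1$, with geodesic distance $\mathrm{dist}$ and Riemannian volume measure $\omega$, and let $\mathscr M(\mathfrak X)$ be the set of Borel probability measures on $\mathfrak X$ with the weak topology. Let $\mathrm g:\mathfrak X\times\mathfrak X\to(-\infty,+\infty]$, $V:\mathfrak X\to(-\infty,+\infty]$ and let $\vartheta:\mathfrak X\to[0,\infty)$ be continuous. For $\kappa\ge0$ put $\widetilde V_\kappa=V-\kappa\vartheta$. Assume the following (Assumptions 2). (i) $\mathrm g$ is symmetric and lower semicontinuous, and for every $\epsilon>0$ there is $\delta>0$ such that $|\mathrm g(u,x)|\le\epsilon\,\mathrm{dist}(u,x)^{-n}$ whenever $\mathrm{dist}(u,x)\le\delta$ (the bound being $+\infty$ if $u=x$). (ii) There are $p>1$ and real numbers $\mathrm c_k\ge0$ with $\mathrm c_k\to0$ such that for every integer $k\ge1$ one can write $\mathrm g=\mathrm g_k+\mathrm g^k$, where $\mathrm g_k:\mathfrak X\times\mathfrak X\to\mathbb R$ is continuous, $\mathrm g_k\le k$, $\mathrm g^k:\mathfrak X\times\mathfrak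 X\to[0,+\infty]$, and $\int\mathrm g^k(u,x)^p\,\omega(dx)\le\mathrm c_k$ for all $u\in\mathfrak X$. (iii) $-\mathrm g(u,x)\le\vartheta(u)+\vartheta(x)$ for all $u,x\in\mathfrak X$. (iv) For every $\kappa\ge0$, $\widetilde V_\kappa$ is bounded from below, the set $\{\widetilde V_\kappa<+\infty\}$ is open and non-empty, $\widetilde V_\kappa$ is continuous on it, and $\int e^{-\widetilde V_\kappa}\,d\omega<+\infty$ (with $e^{-\infty}=0$). For $\gamma\ge0$ and $\mu\in\mathscr M(\mathfrak X)$ define the free energy $$\mathscr F_\gamma(\mu)=\frac\gamma2\iint\big(\mathrm g(x,z)+\vartheta(x)+\vartheta(z)\big)\,\mu(dz)\mu(dx)+\mathrm H(\mu\,|\,\nu_\gamma)\in[0,+\infty],$$ where $\nu_\gamma(dx)=\mathrm C_\gamma^{-1}e^{-\widetilde V_\gamma(x)}\omega(dx)$, with $\mathrm C_\gamma=\int e^{-\widetilde V_\gamma}d\omega$, $\mathrm H$ is the relative entropy, and $0\cdot\infty=0$. Fix $\gamma\ge 0$ and suppose that $\mathscr F_\gamma$ has a unique minimizer $\mu_\gamma$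 in $\mathscr M(\mathfrak X)$. Then: (a) (Law of large numbers.) Let $(\beta_N)_{N\ge1}$ be positive numbers with $\beta_N N\to\gamma$ as $N\to\infty$, and for $N\ge1$ let $$\mathbb P_N[d\mathbf x]=\frac1{\mathrm Z_N}\exp\Big(-\beta_N\sum_{1\le i<j\le N}\mathrm g(x_i,x_j)-\sum_{j=1}^NV(x_j)\Big)\prod_{j=1}^N\omega(dx_j)$$ on $\mathfrak X^N$, where $\mathrm Z_N$ is the integral of the exponential with respect to $\omega^{\otimes N}$. Then every $\mathbb P_N$ is a well-defined probability measure, and under $\mathbb P_N$ the empirical measure $\widehat\mu_N=\frac1N\sum_{j=1}^N\delta_{x_j}$ converges in probability to $\mu_\gamma$: for every neighbourhood $\mathcal U$ of $\mu_\gamma$ in $\mathscr M(\mathfrak X)$, $\mathbb P_N[\widehat\mu_N\notin\mathcal U]\to0$ as $N\to\infty$. (b) (Equilibrium measure.) For every $x\in\mathfrak X$ the function $\mathrm g(x,\cdot)$ is $\mu_\gamma$-almost everywhere finite and $\mu_\gamma$-integrable, the potential $\mathscr U^{\mu_\gamma}(x)=\int\mathrm g(x,z)\,\mu_\gamma(dz)$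 is continuous on $\mathfrak X$, and there is a constant $\mathrm L_\gamma\in(0,\infty)$ such that $$\mu_\gamma(dx)=\mathrm L_\gamma^{-1}\,e^{-\gamma\,\mathscr U^{\mu_\gamma}(x)-V(x)}\,\omega(dx).$$ -/

import Mathlib

open MeasureTheory Filter Topology Bundle InformationTheory
open scoped ENNReal NNReal

noncomputable section

namespace GibbsGas

section Volume

variable {n : ℕ} {M : Type*} [MetricSpace M] [ChartedSpace (EuclideanSpace ℝ (Fin n)) M]

/-- The Gram matrix `(g_{ij})` of the Riemannian metric in the local coordinates given by the
chart `e`, at the point of `M` with coordinates `y`: the entries are the inner products of the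
coordinate vector fields `∂_i`, `∂_j` at `e.symm y`. -/
def gramMatrix [RiemannianBundle
      (fun x : M => TangentSpace (modelWithCornersSelf ℝ (EuclideanSpace ℝ (Fin n))) x)]
    (e : OpenPartialHomeomorph M (EuclideanSpace ℝ (Fin n))) (y : EuclideanSpace ℝ (Fin n)) :
    Matrix (Fin n) (Fin n) ℝ :=
  let D := mfderiv (modelWithCornersSelf ℝ (EuclideanSpace ℝ (Fin n)))
    (modelWithCornersSelf ℝ (EuclideanSpace ℝ (Fin n))) e.symm y
  Matrix.of fun i j =>
    inner ℝ (D (EuclideanSpace.single i (1 : ℝ))) (D (EuclideanSpace.single j (1 : ℝ)))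

/-- The Riemannian volume on the domain of the chart `e`, that is, `√(det g) dx₁ ⋯ dxₙ` in the
coordinates of `e`. -/
def chartVolume [MeasurableSpace M] [RiemannianBundle
      (fun x : M => TangentSpace (modelWithCornersSelf ℝ (EuclideanSpace ℝ (Fin n))) x)]
    (e : OpenPartialHomeomorph M (EuclideanSpace ℝ (Fin n))) : Measure M :=
  ((volume.restrict e.target).withDensity
    fun y => ENNReal.ofReal (Real.sqrt (gramMatrix e y).det)).map e.symm

variable (n M) in
theorem exists_countable_chart_cover [Nonempty M] [SecondCountableTopology M] :
    ∃ c : ℕ → M, (⋃ i, (chartAt (EuclideanSpace ℝ (Fin n)) (c i)).source) = Set.univ := by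
  obtain ⟨s, hs, hcov⟩ := TopologicalSpace.countable_cover_nhds
    (fun x : M => chart_source_mem_nhds (EuclideanSpace ℝ (Fin n)) x)
  have hne : s.Nonempty := by
    rw [Set.nonempty_iff_ne_empty]
    rintro rfl
    exact Set.empty_ne_univ (by simpa using hcov)
  obtain ⟨c, rfl⟩ := hs.exists_eq_range hne
  exact ⟨c, by simpa [Set.biUnion_range] using hcov⟩

variable (n M) in
/-- The centres of a countable family of charts covering `M`. -/
def chartCenter [Nonempty M] [SecondCountableTopology M] : ℕ → M :=
  (exists_countable_chart_cover n M).choose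

variable (n M) in
/-- The Riemannian volume measure of `M`: the chart volumes of a countable family of charts
covering `M`, glued along the partition of `M` obtained by making the chart domains disjoint.
As the chart volumes agree on overlaps, the outcome is the usual volume, whichever the family. -/
def riemannianVolume [Nonempty M] [SecondCountableTopology M] [MeasurableSpace M]
    [RiemannianBundle
      (fun x : M => TangentSpace (modelWithCornersSelf ℝ (EuclideanSpace ℝ (Fin n))) x)] :
    Measure M :=
  Measure.sum fun i =>
    (chartVolume (chartAt (EuclideanSpace ℝ (Fin n)) (chartCenter n M i))).restrict
      (disjointed
        (fun j => (chartAt (EuclideanSpace ℝ (Fin n)) (chartCenter n M j)).source) i)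

end Volume

section Assumptions

variable {M : Type*}

/-- The modified potential `V - κ ϑ`. -/
def shiftedPotential (V : M → EReal) (θ : M → ℝ) (κ : ℝ) (x : M) : EReal :=
  V x - ((κ * θ x : ℝ) : EReal)

variable [MetricSpace M] [MeasurableSpace M]

/-- The condition on a confining potential `W`: it is bounded from below, the set `{W < +∞}` is
open and non-empty, `W` is continuous on it, and `e^{-W}` is integrable
(`EReal.exp ⊥ = 0`, so `e^{-W} = 0` where `W = +∞`). -/
structure IsConfining (ω : Measure M) (W : M → EReal) : Prop where
  bddBelow : ∃ c : ℝ, ∀ x, (c : EReal) ≤ W x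
  isOpen : IsOpen {x | W x < ⊤}
  nonempty : {x | W x < ⊤}.Nonempty
  continuousOn : ContinuousOn W {x | W x < ⊤}
  integrable : ∫⁻ x, EReal.exp (-W x) ∂ω < ⊤

/-- The assumptions on the kernel `g`, the potential `V` and the function `ϑ`, on a space of
dimension `n` with volume measure `ω`. -/
structure Assumptions (n : ℕ) (ω : Measure M) (g : M → M → EReal) (V : M → EReal)
    (θ : M → ℝ) : Prop where
  kernel_ne_bot : ∀ u x, g u x ≠ ⊥
  potential_ne_bot : ∀ x, V x ≠ ⊥
  symm : ∀ u x, g u x = g x u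
  lsc : LowerSemicontinuous fun q : M × M => g q.1 q.2
  /-- `|g(u, x)| ≤ ε dist(u, x)^{-n}` near the diagonal; the bound is `+∞` on the diagonal. -/
  singularity : ∀ ε : ℝ, 0 < ε → ∃ δ : ℝ, 0 < δ ∧ ∀ u x, dist u x ≤ δ →
    (g u x).abs ≤ ENNReal.ofReal ε / edist u x ^ n
  /-- `g = gc k + gs k` with `gc k ≤ k` continuous and `gs k ≥ 0` small in `L^p`, uniformly. -/
  decomposition : ∃ (gc : ℕ → M → M → ℝ) (gs : ℕ → M → M → ℝ≥0∞) (p : ℝ) (c : ℕ → ℝ≥0),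
    1 < p ∧ Tendsto c atTop (𝓝 0) ∧
    ∀ k : ℕ, 1 ≤ k →
      (∀ u x, g u x = (gc k u x : EReal) + (gs k u x : EReal)) ∧
      (∀ u x, gc k u x ≤ k) ∧
      Continuous (fun q : M × M => gc k q.1 q.2) ∧
      ∀ u, ∫⁻ x, gs k u x ^ p ∂ω ≤ c k
  theta_continuous : Continuous θ
  theta_nonneg : ∀ x, 0 ≤ θ x
  neg_kernel_le : ∀ u x, -g u x ≤ ((θ u + θ x : ℝ) : EReal)
  confining : ∀ κ : ℝ, 0 ≤ κ → IsConfining ω (shiftedPotential V θ κ)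

end Assumptions

section Gibbs

variable {M : Type*} [MeasurableSpace M]

/-- The energy `β ∑_{i<j} g(x_i, x_j) + ∑_j V(x_j)` of a configuration. -/
def energy {N : ℕ} (β : ℝ) (g : M → M → EReal) (V : M → EReal) (x : Fin N → M) : EReal :=
  (β : EReal) * (∑ i, ∑ j ∈ Finset.Ioi i, g (x i) (x j)) + ∑ j, V (x j)

/-- The partition function `Z_N`. -/
def partitionFunction (N : ℕ) (ω : Measure M) (β : ℝ) (g : M → M → EReal) (V : M → EReal) :
    ℝ≥0∞ :=
  ∫⁻ x : Fin N → M, EReal.exp (-energy β g V x) ∂(Measure.pi fun _ => ω)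

/-- The Gibbs measure `P_N` on configurations of `N` particles. -/
def gibbsMeasure (N : ℕ) (ω : Measure M) (β : ℝ) (g : M → M → EReal) (V : M → EReal) :
    Measure (Fin N → M) :=
  (partitionFunction N ω β g V)⁻¹ •
    (Measure.pi fun _ => ω).withDensity fun x => EReal.exp (-energy β g V x)

/-- The empirical measure `N⁻¹ ∑_j δ_{x_j}` of a configuration of `N ≥ 1` points. -/
def empiricalMeasure {N : ℕ} [NeZero N] (x : Fin N → M) : ProbabilityMeasure M :=
  ⟨(N : ℝ≥0∞)⁻¹ • ∑ j, Measure.dirac (x j), ⟨by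
    simp [ENNReal.inv_mul_cancel (Nat.cast_ne_zero.2 (NeZero.ne N)) (ENNReal.natCast_ne_top N)]⟩⟩

/-- The weighted energy `∬ (g(x, z) + ϑ(x) + ϑ(z)) μ(dz) μ(dx)`, whose integrand is non-negative
when `-g(x, z) ≤ ϑ(x) + ϑ(z)`. -/
def weightedEnergy (g : M → M → EReal) (θ : M → ℝ) (μ : Measure M) : ℝ≥0∞ :=
  ∫⁻ x, ∫⁻ z, (g x z + ((θ x + θ z : ℝ) : EReal)).toENNReal ∂μ ∂μ

/-- The reference measure `ν_γ = C_γ⁻¹ e^{-(V - γ ϑ)} ω`, `C_γ` being the normalization. -/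
def referenceMeasure (ω : Measure M) (V : M → EReal) (θ : M → ℝ) (γ : ℝ) : Measure M :=
  (∫⁻ x, EReal.exp (-shiftedPotential V θ γ x) ∂ω)⁻¹ •
    ω.withDensity fun x => EReal.exp (-shiftedPotential V θ γ x)

/-- The free energy `F_γ(μ) = (γ / 2) Ẽ(μ) + H(μ | ν_γ)`. -/
def freeEnergy (ω : Measure M) (g : M → M → EReal) (V : M → EReal) (θ : M → ℝ) (γ : ℝ)
    (μ : ProbabilityMeasure M) : ℝ≥0∞ :=
  ENNReal.ofReal (γ / 2) * weightedEnergy g θ (μ : Measure M) +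
    klDiv (μ : Measure M) (referenceMeasure ω V θ γ)

/-- The potential `U^μ(x) = ∫ g(x, z) μ(dz)` generated by `μ`; it is meaningful when `g(x, ·)` is
almost everywhere finite and integrable with respect to `μ`. -/
def potential (g : M → M → EReal) (μ : Measure M) (x : M) : ℝ :=
  ∫ z, (g x z).toReal ∂μ

end Gibbs

end GibbsGas

end

/-!
Let `σ` be the reference measure tilted by `-γ` times the (nonnegative) potential of the minimizer
`μ`. Comparing `μ` with the mixtures `(1 - t) μ + t σ`, the first variation of energy plus entropy
gives `H(μ | σ) ≤ 0`, that is `μ = σ`. Hence `μ ≤ D ω` for a constant `D`. For such measures,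
splitting `g` into a continuous part bounded above and a part that is small in `L^p(ω)` uniformly in
the first variable makes `∫ g(·, z) dμ` upper semicontinuous; Fatou's lemma gives lower
semicontinuity.

Rewriting the partition function as an integral against `μ^{⊗N}` and applying Jensen's inequality
yields `Z_N ≥ exp (N l)` eventually, for every `l < l₀`, where `l₀` is `log C_γ` minus the minimal
free energy. A lower semicontinuous energy and the Donsker–Varadhan formula for the entropy reduce
`ℱ ρ > min ℱ` to an inequality for bounded continuous test functions, which persists near `ρ`; a
Chernoff bound then makes a neighbourhood of every `ρ ≠ μ` exponentially unlikely. Exponential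
tightness, from the integrability of `e^{-V + (γ + 1) ϑ}`, leaves finitely many such neighbourhoods.
-/

open scoped BoundedContinuousFunction

noncomputable section

namespace GibbsGas

section Truncation

/-- The truncation of `y` to the interval `[(n + 1)⁻¹, n + 1]`, on which the logarithm is
bounded. -/
def truncate (n : ℕ) (y : ℝ) : ℝ := max (n + 1 : ℝ)⁻¹ (min y (n + 1))

theorem inv_le_truncate (n : ℕ) (y : ℝ) : (n + 1 : ℝ)⁻¹ ≤ truncate n y := le_max_left _ _

theorem truncate_pos (n : ℕ) (y : ℝ) : 0 < truncate n y :=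
  (by positivity : (0 : ℝ) < (n + 1 : ℝ)⁻¹).trans_le (inv_le_truncate n y)

theorem truncate_le (n : ℕ) (y : ℝ) : truncate n y ≤ n + 1 := by
  have h : (1 : ℝ) ≤ n + 1 := by linarith [n.cast_nonneg (α := ℝ)]
  exact max_le ((inv_le_one_of_one_le₀ h).trans h) (min_le_right _ _)

theorem abs_log_truncate_le (n : ℕ) (y : ℝ) : |Real.log (truncate n y)| ≤ Real.log (n + 1) := by
  rw [abs_le, ← Real.log_inv]
  exact ⟨Real.log_le_log (by positivity) (inv_le_truncate n y),
    Real.log_le_log (truncate_pos n y) (truncate_le n y)⟩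

theorem measurable_truncate (n : ℕ) : Measurable (truncate n) :=
  measurable_const.max (measurable_id.min measurable_const)

theorem tendsto_truncate {y : ℝ} (hy : 0 ≤ y) :
    Tendsto (fun n => truncate n y) atTop (𝓝 y) := by
  have hlow : Tendsto (fun n : ℕ => (n + 1 : ℝ)⁻¹) atTop (𝓝 0) := by
    simpa [one_div] using tendsto_one_div_add_atTop_nhds_zero_nat (𝕜 := ℝ)
  have hup : Tendsto (fun n : ℕ => min y (n + 1 : ℝ)) atTop (𝓝 y) := by
    refine tendsto_const_nhds.congr' ?_
    filter_upwards [(tendsto_natCast_atTop_atTop (R := ℝ)).eventually_ge_atTop y] with n hn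
    rw [min_eq_left (by linarith)]
  simpa [truncate, max_eq_right hy] using hlow.max hup

theorem sub_truncate_mul_log_nonneg (n : ℕ) (y : ℝ) :
    0 ≤ (y - truncate n y) * Real.log (truncate n y) := by
  have hn : (1 : ℝ) ≤ n + 1 := by linarith [n.cast_nonneg (α := ℝ)]
  rcases lt_trichotomy (truncate n y) 1 with hlt | heq | hgt
  · refine mul_nonneg_of_nonpos_of_nonpos (sub_nonpos.2 ?_)
      (Real.log_nonpos (truncate_pos n y).le hlt.le)
    have hmin : min y (n + 1) ≤ truncate n y := le_max_right _ _
    exact (min_le_iff.1 hmin).resolve_right (not_le.2 (hlt.trans_le hn))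
  · simp [heq]
  · refine mul_nonneg (sub_nonneg.2 ?_) (Real.log_nonneg hgt.le)
    exact ((le_max_iff.1 le_rfl).resolve_left
      (not_le.2 ((inv_le_one_of_one_le₀ hn).trans_lt hgt))).trans (min_le_left _ _)

/-- The affine minorant of `klFun` tangent at `truncate n y`, evaluated at `y`: it has the form
`y f - (exp f - 1)` of the Legendre transform, with the bounded slope `f = log (truncate n y)`. -/
def truncatedKLFun (n : ℕ) (y : ℝ) : ℝ :=
  y * Real.log (truncate n y) - (truncate n y - 1)

theorem truncatedKLFun_nonneg (n : ℕ) (y : ℝ) : 0 ≤ truncatedKLFun n y := by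
  have h := klFun_nonneg (truncate_pos n y).le
  rw [klFun_apply] at h
  rw [truncatedKLFun]
  linarith [sub_truncate_mul_log_nonneg n y]

theorem tendsto_truncatedKLFun {y : ℝ} (hy : 0 ≤ y) :
    Tendsto (fun n => truncatedKLFun n y) atTop (𝓝 (klFun y)) := by
  have hlim := tendsto_truncate hy
  rw [klFun_apply, add_sub_assoc, ← neg_sub y 1, ← sub_eq_add_neg]
  refine Tendsto.sub ?_ (hlim.sub_const 1)
  rcases hy.eq_or_lt with rfl | hpos
  · simp
  · exact (hlim.log hpos.ne').const_mul y

end Truncation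

section Entropy

variable {X : Type*} [MeasurableSpace X] {l ν : Measure X}

/-- The Donsker–Varadhan functional `∫ f dl - ∫ (e^f - 1) dν`, of which the relative entropy
`H(l | ν)` is the supremum over `f`. -/
def donskerVaradhan (l ν : Measure X) (f : X → ℝ) : ℝ :=
  ∫ x, f x ∂l - ∫ x, (Real.exp (f x) - 1) ∂ν

theorem absolutelyContinuous_of_forall_donskerVaradhan_le [IsFiniteMeasure l] {a : ℝ}
    (h : ∀ f : X → ℝ, Measurable f → (∃ B, ∀ x, |f x| ≤ B) → donskerVaradhan l ν f ≤ a) :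
    l ≪ ν := by
  refine Measure.AbsolutelyContinuous.mk fun s hs hνs => ?_
  have hbound (t : ℝ) : l.real s * t ≤ a := by
    have hexp : ∫ x, (Real.exp (s.indicator (fun _ => t) x) - 1) ∂ν = 0 := by
      refine integral_eq_zero_of_ae ?_
      filter_upwards [measure_eq_zero_iff_ae_notMem.1 hνs] with x hx
      simp [hx]
    have ht := h (s.indicator fun _ => t) (measurable_const.indicator hs)
      ⟨|t|, fun x => by by_cases hx : x ∈ s <;> simp [hx]⟩
    rwa [donskerVaradhan, hexp, integral_indicator_const _ hs, smul_eq_mul, sub_zero] at ht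
  by_contra hls
  have hpos : 0 < l.real s := ENNReal.toReal_pos hls (measure_ne_top _ _)
  have hcontra := hbound ((a + 1) / l.real s)
  rw [mul_div_cancel₀ _ hpos.ne'] at hcontra
  linarith

theorem integrable_truncatedKLFun_rnDeriv [IsFiniteMeasure l] [IsFiniteMeasure ν] (n : ℕ) :
    Integrable (fun x => truncatedKLFun n (l.rnDeriv ν x).toReal) ν := by
  have hm : Measurable fun x => truncate n (l.rnDeriv ν x).toReal :=
    (measurable_truncate n).comp (Measure.measurable_rnDeriv l ν).ennreal_toReal
  refine Integrable.sub ?_ (Integrable.sub ?_ (integrable_const _))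
  · exact Measure.integrable_toReal_rnDeriv.mul_bdd hm.log.aestronglyMeasurable
      (ae_of_all _ fun x => abs_log_truncate_le n _)
  · refine Integrable.of_bound hm.aestronglyMeasurable (n + 1) (ae_of_all _ fun x => ?_)
    rw [Real.norm_eq_abs, abs_of_pos (truncate_pos n _)]
    exact truncate_le n _

theorem integral_truncatedKLFun_rnDeriv [IsFiniteMeasure l] [IsFiniteMeasure ν] (hac : l ≪ ν)
    (n : ℕ) : ∫ x, truncatedKLFun n (l.rnDeriv ν x).toReal ∂ν =
      donskerVaradhan l ν fun x => Real.log (truncate n (l.rnDeriv ν x).toReal) := by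
  have hm : Measurable fun x => truncate n (l.rnDeriv ν x).toReal :=
    (measurable_truncate n).comp (Measure.measurable_rnDeriv l ν).ennreal_toReal
  have hlog : Integrable (fun x => (l.rnDeriv ν x).toReal *
      Real.log (truncate n (l.rnDeriv ν x).toReal)) ν :=
    Measure.integrable_toReal_rnDeriv.mul_bdd hm.log.aestronglyMeasurable
      (ae_of_all _ fun x => abs_log_truncate_le n _)
  have htrunc : Integrable (fun x => truncate n (l.rnDeriv ν x).toReal - 1) ν := by
    convert hlog.sub (integrable_truncatedKLFun_rnDeriv (l := l) n) using 1
    ext x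
    simp [truncatedKLFun]
  simp only [donskerVaradhan, Real.exp_log (truncate_pos n _)]
  rw [← integral_rnDeriv_smul hac]
  simp only [smul_eq_mul]
  rw [← integral_sub hlog htrunc]
  rfl

theorem klDiv_le_of_forall_measurable [IsFiniteMeasure l] [IsFiniteMeasure ν] {a : ℝ}
    (h : ∀ f : X → ℝ, Measurable f → (∃ B, ∀ x, |f x| ≤ B) → donskerVaradhan l ν f ≤ a) :
    klDiv l ν ≤ ENNReal.ofReal a := by
  have hac := absolutelyContinuous_of_forall_donskerVaradhan_le h
  have hφ : Measurable fun x => (l.rnDeriv ν x).toReal :=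
    (Measure.measurable_rnDeriv l ν).ennreal_toReal
  have hm (n : ℕ) := (measurable_truncate n).comp hφ
  rw [klDiv_eq_lintegral_klFun_of_ac hac]
  calc ∫⁻ x, ENNReal.ofReal (klFun (l.rnDeriv ν x).toReal) ∂ν
      = ∫⁻ x, liminf (fun n =>
          ENNReal.ofReal (truncatedKLFun n (l.rnDeriv ν x).toReal)) atTop ∂ν :=
        lintegral_congr fun x => ((ENNReal.tendsto_ofReal
          (tendsto_truncatedKLFun ENNReal.toReal_nonneg)).liminf_eq).symm
    _ ≤ liminf (fun n =>
          ∫⁻ x, ENNReal.ofReal (truncatedKLFun n (l.rnDeriv ν x).toReal) ∂ν) atTop :=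
        lintegral_liminf_le fun n =>
          ((hφ.mul (hm n).log).sub ((hm n).sub_const 1)).ennreal_ofReal
    _ ≤ ENNReal.ofReal a := by
        refine liminf_le_of_frequently_le' (Frequently.of_forall fun n => ?_)
        rw [← ofReal_integral_eq_lintegral_ofReal (integrable_truncatedKLFun_rnDeriv n)
          (ae_of_all _ fun x => truncatedKLFun_nonneg n _), integral_truncatedKLFun_rnDeriv hac]
        exact ENNReal.ofReal_le_ofReal (h _ (hm n).log ⟨_, fun x => abs_log_truncate_le n _⟩)

theorem exp_sub_exp_le {s t B : ℝ} (hs : s ≤ B) :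
    Real.exp s - Real.exp t ≤ Real.exp B * |t - s| := by
  have htangent := Real.add_one_le_exp (t - s)
  calc Real.exp s - Real.exp t = Real.exp s * (1 - Real.exp (t - s)) := by
        rw [mul_sub, ← Real.exp_add, mul_one, add_sub_cancel]
    _ ≤ Real.exp s * |t - s| :=
        mul_le_mul_of_nonneg_left (by linarith [neg_abs_le (t - s)]) (Real.exp_pos s).le
    _ ≤ Real.exp B * |t - s| :=
        mul_le_mul_of_nonneg_right (Real.exp_le_exp.2 hs) (abs_nonneg _)

theorem donskerVaradhan_le_add [IsFiniteMeasure l] [IsFiniteMeasure ν] {f v : X → ℝ} {B : ℝ}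
    (hf : Measurable f) (hv : Measurable v) (hfB : ∀ x, |f x| ≤ B) (hvB : ∀ x, |v x| ≤ B) :
    donskerVaradhan l ν f ≤
      donskerVaradhan l ν v + (1 + Real.exp B) * ∫ x, |f x - v x| ∂(l + ν) := by
  have hbdd_int {w : X → ℝ} (hw : Measurable w) (hwB : ∀ x, |w x| ≤ B) (ρ : Measure X)
      [IsFiniteMeasure ρ] : Integrable w ρ :=
    Integrable.of_bound hw.aestronglyMeasurable B (ae_of_all _ hwB)
  have hexp {w : X → ℝ} (hw : Measurable w) (hwB : ∀ x, |w x| ≤ B) :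
      Integrable (fun x => Real.exp (w x) - 1) ν := by
    refine (Integrable.of_bound hw.exp.aestronglyMeasurable (Real.exp B)
      (ae_of_all _ fun x => ?_)).sub (integrable_const _)
    rw [Real.norm_eq_abs, Real.abs_exp]
    exact Real.exp_le_exp.2 (le_of_abs_le (hwB x))
  have hdiff (ρ : Measure X) [IsFiniteMeasure ρ] : Integrable (fun x => |f x - v x|) ρ :=
    ((hbdd_int hf hfB ρ).sub (hbdd_int hv hvB ρ)).abs
  have hl : ∫ x, f x ∂l ≤ ∫ x, v x ∂l + ∫ x, |f x - v x| ∂l := by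
    rw [← integral_add (hbdd_int hv hvB l) (hdiff l)]
    refine integral_mono (hbdd_int hf hfB l) ((hbdd_int hv hvB l).add (hdiff l)) fun x => ?_
    simp only
    linarith [le_abs_self (f x - v x)]
  have hν : ∫ x, (Real.exp (v x) - 1) ∂ν ≤
      ∫ x, (Real.exp (f x) - 1) ∂ν + Real.exp B * ∫ x, |f x - v x| ∂ν := by
    rw [← integral_const_mul, ← integral_add (hexp hf hfB) ((hdiff ν).const_mul _)]
    refine integral_mono (hexp hv hvB) ((hexp hf hfB).add ((hdiff ν).const_mul _)) fun x => ?_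
    simp only
    linarith [exp_sub_exp_le (t := f x) (le_of_abs_le (hvB x))]
  have hl₀ : 0 ≤ ∫ x, |f x - v x| ∂l := integral_nonneg fun x => abs_nonneg _
  have hν₀ : 0 ≤ ∫ x, |f x - v x| ∂ν := integral_nonneg fun x => abs_nonneg _
  rw [integral_add_measure (hdiff l) (hdiff ν), donskerVaradhan, donskerVaradhan]
  linarith [mul_nonneg (Real.exp_pos B).le hl₀]

theorem klDiv_le_of_forall_boundedContinuous [TopologicalSpace X] [NormalSpace X] [BorelSpace X]
    [IsFiniteMeasure l] [IsFiniteMeasure ν] [(l + ν).WeaklyRegular] {a : ℝ}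
    (h : ∀ f : X →ᵇ ℝ, donskerVaradhan l ν f ≤ a) :
    klDiv l ν ≤ ENNReal.ofReal a := by
  refine klDiv_le_of_forall_measurable fun f hf ⟨B, hB⟩ => le_of_forall_pos_le_add fun ε hε => ?_
  have hfi : Integrable f (l + ν) :=
    Integrable.of_bound hf.aestronglyMeasurable B (ae_of_all _ hB)
  obtain ⟨u, hu, hui⟩ := hfi.exists_boundedContinuous_integral_sub_le
    (ε := ε / (1 + Real.exp B)) (by positivity)
  rcases isEmpty_or_nonempty X with hX | ⟨⟨x₀⟩⟩
  · simpa [donskerVaradhan, integral_of_isEmpty] using (h 0).trans (le_add_of_nonneg_right hε.le)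
  have hBB : -B ≤ B := by linarith [(abs_nonneg _).trans (hB x₀)]
  have hproj (x : X) : |(Set.projIcc (-B) B hBB (u x) : ℝ)| ≤ B :=
    abs_le.2 (Set.projIcc (-B) B hBB (u x)).2
  let v : X →ᵇ ℝ := BoundedContinuousFunction.ofNormedAddCommGroup
    (fun x => (Set.projIcc (-B) B hBB (u x) : ℝ))
    (continuous_subtype_val.comp (continuous_projIcc.comp u.continuous)) B hproj
  have hclose (x : X) : |f x - v x| ≤ ‖f x - u x‖ := by
    have hfx : (Set.projIcc (-B) B hBB (f x) : ℝ) = f x :=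
      congrArg Subtype.val (Set.projIcc_of_mem hBB (abs_le.1 (hB x)))
    calc |f x - v x| = |(Set.projIcc (-B) B hBB (f x) : ℝ) - Set.projIcc (-B) B hBB (u x)| := by
          rw [hfx]; rfl
      _ ≤ ‖f x - u x‖ := Set.abs_projIcc_sub_projIcc hBB
  have hL1 : ∫ x, |f x - v x| ∂(l + ν) ≤ ε / (1 + Real.exp B) :=
    (integral_mono_of_nonneg (ae_of_all _ fun x => abs_nonneg _) (hfi.sub hui).norm
      (ae_of_all _ hclose)).trans hu
  calc donskerVaradhan l ν f
      ≤ donskerVaradhan l ν v + (1 + Real.exp B) * ∫ x, |f x - v x| ∂(l + ν) :=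
        donskerVaradhan_le_add hf v.continuous.measurable hB hproj
    _ ≤ a + ε := by
        refine add_le_add (h v) ?_
        rwa [le_div_iff₀' (by positivity)] at hL1

theorem klDiv_add_smul_le {l₁ l₂ : Measure X} [IsFiniteMeasure ν] [IsFiniteMeasure l₁]
    [IsFiniteMeasure l₂] (h₁ : l₁ ≪ ν) (h₂ : l₂ ≪ ν) {s t : ℝ≥0} (hst : s + t = 1) :
    klDiv (s • l₁ + t • l₂) ν ≤ s * klDiv l₁ ν + t * klDiv l₂ ν := by
  rw [klDiv_eq_lintegral_klFun_of_ac
      (Measure.AbsolutelyContinuous.add_left_iff.2 ⟨h₁.smul_left s, h₂.smul_left t⟩),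
    klDiv_eq_lintegral_klFun_of_ac h₁, klDiv_eq_lintegral_klFun_of_ac h₂,
    ← lintegral_const_mul' _ _ ENNReal.coe_ne_top, ← lintegral_const_mul' _ _ ENNReal.coe_ne_top,
    ← lintegral_add_left (by fun_prop)]
  refine lintegral_mono_ae ?_
  filter_upwards [Measure.rnDeriv_add (s • l₁) (t • l₂) ν, Measure.rnDeriv_smul_left l₁ ν s,
    Measure.rnDeriv_smul_left l₂ ν t, Measure.rnDeriv_lt_top l₁ ν, Measure.rnDeriv_lt_top l₂ ν]
    with x hadd hs ht hfin₁ hfin₂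
  have hrn : ((s • l₁ + t • l₂).rnDeriv ν x).toReal =
      s * (l₁.rnDeriv ν x).toReal + t * (l₂.rnDeriv ν x).toReal := by
    rw [hadd, Pi.add_apply, hs, ht]
    simp only [Pi.smul_apply, ENNReal.smul_def, smul_eq_mul]
    rw [ENNReal.toReal_add (by finiteness) (by finiteness), ENNReal.toReal_mul,
      ENNReal.toReal_mul, ENNReal.coe_toReal, ENNReal.coe_toReal]
  have hconv := convexOn_klFun.2 (x := (l₁.rnDeriv ν x).toReal) ENNReal.toReal_nonneg
    (y := (l₂.rnDeriv ν x).toReal) ENNReal.toReal_nonneg s.coe_nonneg t.coe_nonneg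
    (by exact_mod_cast hst)
  rw [hrn]
  refine (ENNReal.ofReal_le_ofReal hconv).trans_eq ?_
  have hnonneg (r : ℝ≥0) {y : ℝ} (hy : 0 ≤ y) : 0 ≤ (r : ℝ) * klFun y :=
    mul_nonneg r.coe_nonneg (klFun_nonneg hy)
  simp only [smul_eq_mul]
  rw [ENNReal.ofReal_add (hnonneg s ENNReal.toReal_nonneg) (hnonneg t ENNReal.toReal_nonneg),
    ENNReal.ofReal_mul s.coe_nonneg, ENNReal.ofReal_mul t.coe_nonneg, ENNReal.ofReal_coe_nnreal,
    ENNReal.ofReal_coe_nnreal]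

theorem mul_le_klFun_add_exp {r : ℝ} (hr : 0 ≤ r) (t : ℝ) : r * t ≤ klFun r + Real.exp t := by
  rw [klFun_apply]
  rcases hr.eq_or_lt with rfl | hpos
  · simp only [zero_mul, zero_add, sub_zero]
    linarith [Real.exp_pos t]
  · have htangent := Real.add_one_le_exp (t - Real.log r)
    rw [Real.exp_sub, Real.exp_log hpos, le_div_iff₀ hpos] at htangent
    linarith

theorem integrable_of_klDiv_ne_top [IsFiniteMeasure l] [IsFiniteMeasure ν]
    (hkl : klDiv l ν ≠ ∞) {f : X → ℝ} (hf : Measurable f) (hf₀ : ∀ x, 0 ≤ f x)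
    (hexp : ∫⁻ x, ENNReal.ofReal (Real.exp (f x)) ∂ν < ∞) : Integrable f l := by
  have hac : l ≪ ν := (klDiv_ne_top_iff.1 hkl).1
  rw [klDiv_eq_lintegral_klFun_of_ac hac] at hkl
  refine ⟨hf.aestronglyMeasurable, ?_⟩
  rw [hasFiniteIntegral_iff_ofReal (ae_of_all _ hf₀),
    ← lintegral_rnDeriv_mul hac hf.ennreal_ofReal.aemeasurable]
  refine lt_of_le_of_lt ?_ (ENNReal.add_lt_top.2 ⟨hkl.lt_top, hexp⟩)
  rw [← lintegral_add_left (by fun_prop)]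
  refine lintegral_mono_ae ?_
  filter_upwards [Measure.rnDeriv_lt_top l ν] with x hx
  have hr : 0 ≤ (l.rnDeriv ν x).toReal := ENNReal.toReal_nonneg
  rw [← ENNReal.ofReal_add (klFun_nonneg hr) (Real.exp_pos _).le,
    ← ENNReal.ofReal_toReal hx.ne, ← ENNReal.ofReal_mul hr, ENNReal.ofReal_toReal hx.ne]
  exact ENNReal.ofReal_le_ofReal (mul_le_klFun_add_exp hr _)

end Entropy

section Semicontinuity

theorem lowerSemicontinuous_lintegral {X Y : Type*} [TopologicalSpace X] [FirstCountableTopology X]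
    [MeasurableSpace Y] {μ : Measure Y} {f : X → Y → ℝ≥0∞} (hm : ∀ x, Measurable (f x))
    (hf : ∀ y, LowerSemicontinuous fun x => f x y) :
    LowerSemicontinuous fun x => ∫⁻ y, f x y ∂μ := by
  refine lowerSemicontinuous_iff_le_liminf.2 fun x => ?_
  calc ∫⁻ y, f x y ∂μ ≤ ∫⁻ y, liminf (fun x' => f x' y) (𝓝 x) ∂μ :=
        lintegral_mono fun y => lowerSemicontinuous_iff_le_liminf.1 (hf y) x
    _ ≤ liminf (fun x' => ∫⁻ y, f x' y ∂μ) (𝓝 x) :=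
        lintegral_liminf_le' fun x' => (hm x').aemeasurable

variable {X : Type*} [PseudoMetricSpace X]

/-- The infimal convolution of `min G n` with `n` times the distance, that is, the largest
`n`-Lipschitz function below `min G n`. -/
def lipschitzMinorant (G : X → ℝ≥0∞) (n : ℕ) (q : X) : ℝ :=
  ⨅ z, ((min (G z) n).toReal + n * dist q z)

variable (G : X → ℝ≥0∞) (n : ℕ)

theorem lipschitzMinorant_nonneg (q : X) : 0 ≤ lipschitzMinorant G n q :=
  Real.iInf_nonneg fun z => by positivity

theorem lipschitzMinorant_le_add (q z : X) :
    lipschitzMinorant G n q ≤ (min (G z) n).toReal + n * dist q z :=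
  ciInf_le ⟨0, by rintro _ ⟨z, rfl⟩; positivity⟩ z

theorem lipschitzMinorant_le_toReal_min (q : X) :
    lipschitzMinorant G n q ≤ (min (G q) n).toReal := by
  simpa using lipschitzMinorant_le_add G n q q

theorem lipschitzMinorant_le_natCast (q : X) : lipschitzMinorant G n q ≤ n :=
  (lipschitzMinorant_le_toReal_min G n q).trans
    (ENNReal.toReal_le_of_le_ofReal n.cast_nonneg (by simp))

theorem ofReal_lipschitzMinorant_le (q : X) : ENNReal.ofReal (lipschitzMinorant G n q) ≤ G q :=
  (ENNReal.ofReal_le_of_le_toReal (lipschitzMinorant_le_toReal_min G n q)).trans (min_le_left _ _)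

theorem lipschitzWith_lipschitzMinorant : LipschitzWith n (lipschitzMinorant G n) := by
  refine LipschitzWith.of_le_add_mul _ fun q q' => ?_
  have : Nonempty X := ⟨q⟩
  rw [← sub_le_iff_le_add]
  refine le_ciInf fun z => ?_
  have htriangle := mul_le_mul_of_nonneg_left (dist_triangle q q' z) (n.cast_nonneg (α := ℝ))
  rw [NNReal.coe_natCast]
  linarith [lipschitzMinorant_le_add G n q z]

/-- The Lipschitz minorant as a bounded continuous function. -/
def boundedLipschitzMinorant : X →ᵇ ℝ :=
  .ofNormedAddCommGroup (lipschitzMinorant G n) (lipschitzWith_lipschitzMinorant G n).continuous n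
    fun q => by
      rw [Real.norm_eq_abs, abs_of_nonneg (lipschitzMinorant_nonneg G n q)]
      exact lipschitzMinorant_le_natCast G n q

variable {G n}

theorem le_lipschitzMinorant {a r : ℝ} {q : X} (hr : 0 < r)
    (hball : ∀ z, dist z q < r → ENNReal.ofReal a ≤ G z) (hn : max a (a / r) ≤ n) :
    a ≤ lipschitzMinorant G n q := by
  have : Nonempty X := ⟨q⟩
  refine le_ciInf fun z => ?_
  rcases lt_or_ge (dist z q) r with hz | hz
  · have hmin : ENNReal.ofReal a ≤ min (G z) n :=
      le_min (hball z hz) (by simpa using ENNReal.ofReal_le_ofReal ((le_max_left _ _).trans hn))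
    have ha : a ≤ (min (G z) n).toReal :=
      (ENNReal.ofReal_le_iff_le_toReal (by simp)).1 hmin
    linarith [mul_nonneg (n.cast_nonneg (α := ℝ)) (dist_nonneg (x := q) (y := z))]
  · have ha : a ≤ n * r := (div_le_iff₀ hr).1 ((le_max_right _ _).trans hn)
    have hdist : (n : ℝ) * r ≤ n * dist q z :=
      mul_le_mul_of_nonneg_left (dist_comm q z ▸ hz) n.cast_nonneg
    linarith [ENNReal.toReal_nonneg (a := min (G z) n)]

theorem le_liminf_lipschitzMinorant (hG : LowerSemicontinuous G) (q : X) :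
    G q ≤ liminf (fun n => ENNReal.ofReal (lipschitzMinorant G n q)) atTop := by
  refine le_of_forall_lt_imp_le_of_dense fun a ha => ?_
  have ha_top : a ≠ ∞ := (ha.trans_le le_top).ne
  obtain ⟨r, hr, hball⟩ := Metric.eventually_nhds_iff.1 (hG q a ha)
  refine le_liminf_of_le (by isBoundedDefault) ?_
  filter_upwards [(tendsto_natCast_atTop_atTop (R := ℝ)).eventually_ge_atTop
    (max a.toReal (a.toReal / r))] with n hn
  rw [← ENNReal.ofReal_toReal ha_top]
  refine ENNReal.ofReal_le_ofReal (le_lipschitzMinorant hr (fun z hz => ?_) hn)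
  rw [ENNReal.ofReal_toReal ha_top]
  exact (hball hz).le

end Semicontinuity

section Product

theorem lintegral_fin_prod_eq_prod {X : Type*} [MeasurableSpace X] {N : ℕ}
    (μ : Fin N → Measure X) [∀ i, SigmaFinite (μ i)] {f : Fin N → X → ℝ≥0∞}
    (hf : ∀ i, Measurable (f i)) :
    ∫⁻ x, ∏ i, f i (x i) ∂Measure.pi μ = ∏ i, ∫⁻ y, f i y ∂μ i := by
  induction N with
  | zero => simp
  | succ N ih =>
    have hm : Measurable fun x : Fin (N + 1) → X => ∏ i, f i (x i) :=
      Finset.measurable_fun_prod _ fun i _ => (hf i).comp (measurable_pi_apply i)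
    have hm' : Measurable fun x : Fin N → X => ∏ i, f i.succ (x i) :=
      Finset.measurable_fun_prod _ fun i _ => (hf _).comp (measurable_pi_apply i)
    rw [← ((measurePreserving_piFinSuccAbove μ 0).symm).lintegral_comp hm]
    simp only [MeasurableEquiv.piFinSuccAbove_symm_apply, Fin.insertNthEquiv_zero,
      Fin.consEquiv_apply, Fin.prod_univ_succ, Fin.cons_zero, Fin.cons_succ]
    rw [lintegral_prod_mul (hf 0).aemeasurable hm'.aemeasurable]
    congr 1
    exact ih (fun i => μ i.succ) fun i => hf i.succ

theorem pi_withDensity {X : Type*} [MeasurableSpace X] {N : ℕ} (μ : Fin N → Measure X)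
    [∀ i, SigmaFinite (μ i)] {φ : Fin N → X → ℝ≥0∞} (hφ : ∀ i, Measurable (φ i))
    [∀ i, SigmaFinite ((μ i).withDensity (φ i))] :
    (Measure.pi fun i => (μ i).withDensity (φ i)) =
      (Measure.pi μ).withDensity fun x => ∏ i, φ i (x i) := by
  refine Measure.pi_eq fun s hs => ?_
  have hindicator (x : Fin N → X) : (Set.univ.pi s).indicator (fun x => ∏ i, φ i (x i)) x =
      ∏ i, (s i).indicator (φ i) (x i) := by
    by_cases hx : x ∈ Set.univ.pi s
    · rw [Set.indicator_of_mem hx]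
      exact Finset.prod_congr rfl fun i _ => (Set.indicator_of_mem (hx i (Set.mem_univ i)) _).symm
    · rw [Set.indicator_of_notMem hx]
      simp only [Set.mem_univ_pi, not_forall] at hx
      obtain ⟨i, hi⟩ := hx
      exact (Finset.prod_eq_zero (Finset.mem_univ i) (Set.indicator_of_notMem hi _)).symm
  rw [withDensity_apply _ (MeasurableSet.univ_pi hs),
    ← lintegral_indicator (MeasurableSet.univ_pi hs), lintegral_congr hindicator,
    lintegral_fin_prod_eq_prod μ fun i => (hφ i).indicator (hs i)]
  refine Finset.prod_congr rfl fun i _ => ?_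
  rw [lintegral_indicator (hs i), withDensity_apply _ (hs i)]

theorem map_eval_pair_pi {ι : Type*} [Fintype ι] {X : ι → Type*} [∀ i, MeasurableSpace (X i)]
    (μ : ∀ i, Measure (X i)) [∀ i, IsProbabilityMeasure (μ i)] {i j : ι}
    (hij : i ≠ j) : (Measure.pi μ).map (fun x => (x i, x j)) = (μ i).prod (μ j) := by
  have hindep := (ProbabilityTheory.iIndepFun_pi (μ := μ) (X := fun i => (id : X i → X i))
    fun _ => aemeasurable_id).indepFun hij
  have hmap := (ProbabilityTheory.indepFun_iff_map_prod_eq_prod_map_map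
    (measurable_pi_apply i).aemeasurable (measurable_pi_apply j).aemeasurable).1 hindep
  rwa [(measurePreserving_eval μ i).map_eq, (measurePreserving_eval μ j).map_eq] at hmap

end Product

section Tilted

variable {X : Type*} [MeasurableSpace X] {μ ν : Measure X} {f : X → ℝ}

theorem integrable_exp_of_nonpos [IsFiniteMeasure ν] (hf : Measurable f) (hf₀ : ∀ x, f x ≤ 0) :
    Integrable (fun x => Real.exp (f x)) ν := by
  refine Integrable.of_bound hf.exp.aestronglyMeasurable 1 (ae_of_all _ fun x => ?_)
  rw [Real.norm_eq_abs, abs_of_pos (Real.exp_pos _)]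
  exact Real.exp_le_one_iff.2 (hf₀ x)

theorem tilted_le_smul (hf₀ : ∀ x, f x ≤ 0) :
    ν.tilted f ≤ ((∫ x, Real.exp (f x) ∂ν)⁻¹).toNNReal • ν := by
  rw [Measure.tilted]
  refine (withDensity_mono (ae_of_all _ fun x => ENNReal.ofReal_le_ofReal ?_)).trans_eq
    (withDensity_const (μ := ν) (((∫ x, Real.exp (f x) ∂ν)⁻¹).toNNReal : ℝ≥0∞))
  rw [← one_div]
  exact div_le_div_of_nonneg_right (Real.exp_le_one_iff.2 (hf₀ x))
    (integral_nonneg fun _ => (Real.exp_pos _).le)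

theorem klDiv_tilted_left_ne_top [IsProbabilityMeasure ν]
    (hexp : Integrable (fun x => Real.exp (f x)) ν) (hf : Integrable f (ν.tilted f)) :
    klDiv (ν.tilted f) ν ≠ ∞ := by
  have := isProbabilityMeasure_tilted hexp
  have hac := tilted_absolutelyContinuous ν f
  exact klDiv_ne_top hac ((integrable_congr (hac.ae_le (log_rnDeriv_tilted_left_self hexp))).2
    (hf.sub (integrable_const _)))

theorem toReal_klDiv_tilted_left [IsProbabilityMeasure ν]
    (hexp : Integrable (fun x => Real.exp (f x)) ν) (hf : Integrable f (ν.tilted f)) :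
    (klDiv (ν.tilted f) ν).toReal =
      ∫ x, f x ∂(ν.tilted f) - Real.log (∫ x, Real.exp (f x) ∂ν) := by
  have := isProbabilityMeasure_tilted hexp
  have hac := tilted_absolutelyContinuous ν f
  have hllr : llr (ν.tilted f) ν =ᵐ[ν.tilted f]
      fun x => f x - Real.log (∫ x, Real.exp (f x) ∂ν) :=
    hac.ae_le (log_rnDeriv_tilted_left_self hexp)
  rw [toReal_klDiv_of_measure_eq hac (by simp), integral_congr_ae hllr,
    integral_sub hf (integrable_const _)]
  simp

theorem klDiv_tilted_right_ne_top [IsProbabilityMeasure μ] [IsProbabilityMeasure ν]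
    (hexp : Integrable (fun x => Real.exp (f x)) ν) (hf : Integrable f μ) (hkl : klDiv μ ν ≠ ∞) :
    klDiv μ (ν.tilted f) ≠ ∞ := by
  obtain ⟨hac, hllr⟩ := klDiv_ne_top_iff.1 hkl
  exact klDiv_ne_top (hac.trans (absolutelyContinuous_tilted hexp))
    (integrable_llr_tilted_right hac hf hllr hexp)

theorem toReal_klDiv_tilted_right [IsProbabilityMeasure μ] [IsProbabilityMeasure ν]
    (hexp : Integrable (fun x => Real.exp (f x)) ν) (hf : Integrable f μ) (hkl : klDiv μ ν ≠ ∞) :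
    (klDiv μ (ν.tilted f)).toReal =
      (klDiv μ ν).toReal - ∫ x, f x ∂μ + Real.log (∫ x, Real.exp (f x) ∂ν) := by
  have := isProbabilityMeasure_tilted hexp
  obtain ⟨hac, hllr⟩ := klDiv_ne_top_iff.1 hkl
  rw [toReal_klDiv_of_measure_eq (hac.trans (absolutelyContinuous_tilted hexp)) (by simp),
    toReal_klDiv_of_measure_eq hac (by simp), integral_llr_tilted_right hac hf hexp hllr]

theorem eq_tilted_of_toReal_klDiv_sub_integral_le [IsProbabilityMeasure μ]
    [IsProbabilityMeasure ν] (hexp : Integrable (fun x => Real.exp (f x)) ν)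
    (hf : Integrable f μ) (hf' : Integrable f (ν.tilted f)) (hkl : klDiv μ ν ≠ ∞)
    (hle : (klDiv μ ν).toReal - ∫ x, f x ∂μ ≤
      (klDiv (ν.tilted f) ν).toReal - ∫ x, f x ∂(ν.tilted f)) :
    μ = ν.tilted f := by
  have := isProbabilityMeasure_tilted hexp
  have hnonpos : (klDiv μ (ν.tilted f)).toReal ≤ 0 := by
    rw [toReal_klDiv_tilted_left hexp hf'] at hle
    rw [toReal_klDiv_tilted_right hexp hf hkl]
    linarith
  have hzero := (ENNReal.toReal_eq_zero_iff _).1 (le_antisymm hnonpos ENNReal.toReal_nonneg)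
  exact klDiv_eq_zero_iff.1 (hzero.resolve_right (klDiv_tilted_right_ne_top hexp hf hkl))

end Tilted

section KernelEnergy

theorem nonneg_of_forall_mul_add_mul_sq {a b : ℝ}
    (h : ∀ t : ℝ, 0 < t → t < 1 → 0 ≤ t * a + t ^ 2 * b) : 0 ≤ a := by
  have hlim : Tendsto (fun t : ℝ => a + t * b) (𝓝[>] 0) (𝓝 a) := by
    have hcont : Continuous fun t : ℝ => a + t * b := by fun_prop
    simpa using (hcont.tendsto 0).mono_left nhdsWithin_le_nhds
  refine ge_of_tendsto hlim ?_
  filter_upwards [Ioo_mem_nhdsGT (zero_lt_one' ℝ)] with t ht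
  refine nonneg_of_mul_nonneg_right (a := t) ?_ ht.1
  linarith [h t ht.1 ht.2]

variable {X : Type*} [MeasurableSpace X] {K : X → X → ℝ≥0∞}

/-- The potential `x ↦ ∫ K(x, z) μ(dz)` generated by `μ` through a non-negative kernel `K`. -/
def kernelPotential (K : X → X → ℝ≥0∞) (μ : Measure X) (x : X) : ℝ≥0∞ :=
  ∫⁻ z, K x z ∂μ

/-- The interaction energy `∬ K(x, z) μ(dz) μ(dx)` of `μ` for a non-negative kernel `K`. -/
def kernelEnergy (K : X → X → ℝ≥0∞) (μ : Measure X) : ℝ≥0∞ :=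
  ∫⁻ x, kernelPotential K μ x ∂μ

theorem kernelPotential_const_mul {c : ℝ≥0∞} (hc : c ≠ ∞) (μ : Measure X) (x : X) :
    kernelPotential (fun x z => c * K x z) μ x = c * kernelPotential K μ x :=
  lintegral_const_mul' _ _ hc

theorem kernelEnergy_const_mul {c : ℝ≥0∞} (hc : c ≠ ∞) (μ : Measure X) :
    kernelEnergy (fun x z => c * K x z) μ = c * kernelEnergy K μ := by
  simp_rw [kernelEnergy, kernelPotential_const_mul hc]
  exact lintegral_const_mul' _ _ hc

theorem measurable_kernelPotential (hm : Measurable fun q : X × X => K q.1 q.2) (μ : Measure X)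
    [SFinite μ] : Measurable (kernelPotential K μ) :=
  hm.lintegral_prod_right'

theorem lintegral_kernelPotential_comm (hm : Measurable fun q : X × X => K q.1 q.2)
    (hs : ∀ x z, K x z = K z x) (μ σ : Measure X) [SFinite μ] [SFinite σ] :
    ∫⁻ x, kernelPotential K σ x ∂μ = ∫⁻ x, kernelPotential K μ x ∂σ := by
  simp only [kernelPotential]
  rw [lintegral_lintegral_swap hm.aemeasurable]
  simp_rw [hs]

theorem kernelPotential_add_smul (μ σ : Measure X) (s t : ℝ≥0) (x : X) :
    kernelPotential K (s • μ + t • σ) x =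
      s * kernelPotential K μ x + t * kernelPotential K σ x := by
  simp only [kernelPotential, lintegral_add_measure, lintegral_smul_measure, ENNReal.smul_def,
    smul_eq_mul]

theorem kernelEnergy_add_smul (hm : Measurable fun q : X × X => K q.1 q.2)
    (hs : ∀ x z, K x z = K z x) (μ σ : Measure X) [SFinite μ] [SFinite σ] (s t : ℝ≥0) :
    kernelEnergy K (s • μ + t • σ) = s ^ 2 * kernelEnergy K μ +
      2 * s * t * ∫⁻ x, kernelPotential K μ x ∂σ + t ^ 2 * kernelEnergy K σ := by
  have hsplit (ρ : Measure X) : ∫⁻ x, kernelPotential K (s • μ + t • σ) x ∂ρ =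
      s * ∫⁻ x, kernelPotential K μ x ∂ρ + t * ∫⁻ x, kernelPotential K σ x ∂ρ := by
    have hμ := measurable_kernelPotential hm μ
    have hσ := measurable_kernelPotential hm σ
    simp_rw [kernelPotential_add_smul]
    rw [lintegral_add_left (hμ.const_mul _), lintegral_const_mul _ hμ, lintegral_const_mul _ hσ]
  rw [kernelEnergy, lintegral_add_measure, lintegral_smul_measure, lintegral_smul_measure,
    hsplit, hsplit, lintegral_kernelPotential_comm hm hs μ σ, kernelEnergy, kernelEnergy,
    ENNReal.smul_def, ENNReal.smul_def, smul_eq_mul, smul_eq_mul]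
  ring

theorem kernelEnergy_ne_top_of_le_smul {μ σ : Measure X} {c : ℝ≥0} (hle : σ ≤ c • μ)
    (hμ : kernelEnergy K μ ≠ ∞) : kernelEnergy K σ ≠ ∞ := by
  have hbound : kernelEnergy K σ ≤ c * (c * kernelEnergy K μ) := by
    calc kernelEnergy K σ ≤ ∫⁻ x, kernelPotential K (c • μ) x ∂(c • μ) :=
          lintegral_mono' hle fun _ => lintegral_mono' hle le_rfl
      _ = c * (c * kernelEnergy K μ) := by
          simp only [kernelEnergy, kernelPotential, lintegral_smul_measure, ENNReal.smul_def,
            smul_eq_mul]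
          rw [lintegral_const_mul' _ _ ENNReal.coe_ne_top]
  exact ne_top_of_le_ne_top (by finiteness) hbound

variable {μ ν : Measure X} [IsProbabilityMeasure μ]

theorem kernelEnergy_firstVariation_nonneg (hm : Measurable fun q : X × X => K q.1 q.2)
    (hs : ∀ x z, K x z = K z x) [IsFiniteMeasure ν]
    (hmin : ∀ ρ : Measure X, IsProbabilityMeasure ρ →
      kernelEnergy K μ + klDiv μ ν ≤ kernelEnergy K ρ + klDiv ρ ν)
    (hEμ : kernelEnergy K μ ≠ ∞) (hklμ : klDiv μ ν ≠ ∞)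
    {σ : Measure X} [IsProbabilityMeasure σ] (hEσ : kernelEnergy K σ ≠ ∞)
    (hklσ : klDiv σ ν ≠ ∞) (hPσ : ∫⁻ x, kernelPotential K μ x ∂σ ≠ ∞) :
    0 ≤ 2 * ((∫⁻ x, kernelPotential K μ x ∂σ).toReal - (kernelEnergy K μ).toReal) +
      ((klDiv σ ν).toReal - (klDiv μ ν).toReal) := by
  refine nonneg_of_forall_mul_add_mul_sq (b := (kernelEnergy K μ).toReal -
    2 * (∫⁻ x, kernelPotential K μ x ∂σ).toReal + (kernelEnergy K σ).toReal) fun t ht₀ ht₁ => ?_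
  lift t to ℝ≥0 using ht₀.le
  obtain ⟨s, hst⟩ : ∃ s : ℝ≥0, s + t = 1 := ⟨1 - t, tsub_add_cancel_of_le (mod_cast ht₁.le)⟩
  have hs_eq : (s : ℝ) = 1 - t := eq_sub_of_add_eq (mod_cast hst)
  have hprob : IsProbabilityMeasure (s • μ + t • σ) := ⟨by
    simp only [Measure.coe_add, Measure.coe_smul, Pi.add_apply, Pi.smul_apply, measure_univ,
      ENNReal.smul_def, smul_eq_mul, mul_one]
    exact_mod_cast hst⟩
  have hle := (hmin _ hprob).trans (add_le_add_right
    (klDiv_add_smul_le (klDiv_ne_top_iff.1 hklμ).1 (klDiv_ne_top_iff.1 hklσ).1 hst) _)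
  rw [kernelEnergy_add_smul hm hs] at hle
  lift kernelEnergy K μ to ℝ≥0 using hEμ with eμ
  lift kernelEnergy K σ to ℝ≥0 using hEσ with eσ
  lift ∫⁻ x, kernelPotential K μ x ∂σ to ℝ≥0 using hPσ with pσ
  lift klDiv μ ν to ℝ≥0 using hklμ with kμ
  lift klDiv σ ν to ℝ≥0 using hklσ with kσ
  have hle_real : (eμ + kμ : ℝ) ≤
      s ^ 2 * eμ + 2 * s * t * pσ + t ^ 2 * eσ + (s * kμ + t * kσ) := by exact_mod_cast hle
  simp only [ENNReal.coe_toReal]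
  rw [hs_eq] at hle_real
  linarith

theorem eq_tilted_of_forall_kernelEnergy_add_klDiv_le [IsProbabilityMeasure ν]
    (hm : Measurable fun q : X × X => K q.1 q.2) (hs : ∀ x z, K x z = K z x)
    (hmin : ∀ ρ : Measure X, IsProbabilityMeasure ρ →
      kernelEnergy K μ + klDiv μ ν ≤ kernelEnergy K ρ + klDiv ρ ν)
    (hEν : kernelEnergy K ν ≠ ∞) (hPν : ∫⁻ x, kernelPotential K μ x ∂ν ≠ ∞) :
    μ = ν.tilted fun x => -2 * (kernelPotential K μ x).toReal := by
  have hfin : kernelEnergy K μ + klDiv μ ν ≠ ∞ :=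
    ne_top_of_le_ne_top (by simpa using hEν) (hmin ν ‹_›)
  obtain ⟨hEμ, hklμ⟩ := ENNReal.add_ne_top.1 hfin
  have hPm := measurable_kernelPotential hm μ
  set f : X → ℝ := fun x => -2 * (kernelPotential K μ x).toReal with hf
  have hf₀ (x : X) : f x ≤ 0 := by
    have := ENNReal.toReal_nonneg (a := kernelPotential K μ x)
    simp only [hf]
    linarith
  have hexp : Integrable (fun x => Real.exp (f x)) ν :=
    integrable_exp_of_nonpos (hPm.ennreal_toReal.const_mul _) hf₀
  have hσ := isProbabilityMeasure_tilted hexp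
  have hPσ : ∫⁻ x, kernelPotential K μ x ∂(ν.tilted f) ≠ ∞ := by
    refine ne_top_of_le_ne_top ?_ (lintegral_mono' (tilted_le_smul hf₀) le_rfl)
    rw [lintegral_smul_measure]
    exact ENNReal.mul_ne_top ENNReal.coe_ne_top hPν
  have hf_int {ρ : Measure X} (hρ : ∫⁻ x, kernelPotential K μ x ∂ρ ≠ ∞) : Integrable f ρ :=
    (integrable_toReal_of_lintegral_ne_top hPm.aemeasurable hρ).const_mul _
  have hf_integral {ρ : Measure X} (hρ : ∫⁻ x, kernelPotential K μ x ∂ρ ≠ ∞) :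
      ∫ x, f x ∂ρ = -2 * (∫⁻ x, kernelPotential K μ x ∂ρ).toReal := by
    rw [integral_const_mul, integral_toReal hPm.aemeasurable (ae_lt_top hPm hρ)]
  refine eq_tilted_of_toReal_klDiv_sub_integral_le hexp (hf_int hEμ) (hf_int hPσ) hklμ ?_
  have hvar := kernelEnergy_firstVariation_nonneg hm hs hmin hEμ hklμ
    (kernelEnergy_ne_top_of_le_smul (tilted_le_smul hf₀) hEν)
    (klDiv_tilted_left_ne_top hexp (hf_int hPσ)) hPσ
  rw [hf_integral hEμ, hf_integral hPσ]
  change _ - -2 * (kernelEnergy K μ).toReal ≤ _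
  linarith

end KernelEnergy

section Admissible

variable {X : Type*}

/-- The non-negative kernel `g(x, z) + ϑ(x) + ϑ(z)`. -/
def weightedKernel (g : X → X → EReal) (θ : X → ℝ) (x z : X) : ℝ≥0∞ :=
  (g x z + ((θ x + θ z : ℝ) : EReal)).toENNReal

theorem exp_neg_shiftedPotential (V : X → EReal) (θ : X → ℝ) (κ : ℝ) (x : X) :
    EReal.exp (-shiftedPotential V θ κ x) =
      EReal.exp (-V x) * ENNReal.ofReal (Real.exp (κ * θ x)) := by
  rw [shiftedPotential, EReal.neg_sub (Or.inr (EReal.coe_ne_bot _)) (Or.inr (EReal.coe_ne_top _)),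
    EReal.exp_add, EReal.exp_coe]

variable [TopologicalSpace X] [MeasurableSpace X]

/-- The part of the assumptions on `g`, `V` and `ϑ` that the theory of the gas uses. It makes sense
for a measure `ω` on a space without dimension: the behaviour of `g` at the diagonal is controlled
by `decomposition` alone, `V` is only measurable, and `e^{-V} ω` is assumed not to vanish. -/
structure IsAdmissible (ω : Measure X) (g : X → X → EReal) (V : X → EReal) (θ : X → ℝ) :
    Prop where
  symm : ∀ u x, g u x = g x u
  lsc : LowerSemicontinuous fun q : X × X => g q.1 q.2
  decomposition : ∃ p : ℝ, 1 ≤ p ∧ ∀ ε : ℝ≥0∞, ε ≠ 0 →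
    ∃ (k : ℝ) (gc : X → X → ℝ) (gs : X → X → ℝ≥0∞),
      (∀ u x, g u x = (gc u x : EReal) + (gs u x : EReal)) ∧
      (∀ u x, gc u x ≤ k) ∧
      Continuous (fun q : X × X => gc q.1 q.2) ∧
      ∀ u, ∫⁻ x, gs u x ^ p ∂ω ≤ ε
  theta_continuous : Continuous θ
  theta_nonneg : ∀ x, 0 ≤ θ x
  neg_kernel_le : ∀ u x, -g u x ≤ ((θ u + θ x : ℝ) : EReal)
  measurable_potential : Measurable V
  bddBelow : ∀ κ : ℝ, 0 ≤ κ → ∃ c : ℝ, ∀ x, (c : EReal) ≤ shiftedPotential V θ κ x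
  lintegral_lt_top : ∀ κ : ℝ, 0 ≤ κ → ∫⁻ x, EReal.exp (-shiftedPotential V θ κ x) ∂ω < ∞
  lintegral_ne_zero : ∫⁻ x, EReal.exp (-V x) ∂ω ≠ 0

namespace IsAdmissible

variable {ω : Measure X} {g : X → X → EReal} {V : X → EReal} {θ : X → ℝ}

theorem kernel_ne_bot (h : IsAdmissible ω g V θ) (x z : X) : g x z ≠ ⊥ := by
  intro hbot
  have hle := h.neg_kernel_le x z
  rw [hbot, EReal.neg_bot] at hle
  exact EReal.coe_ne_top _ (top_le_iff.1 hle)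

theorem potential_ne_bot (h : IsAdmissible ω g V θ) (x : X) : V x ≠ ⊥ := by
  intro hbot
  obtain ⟨c, hc⟩ := h.bddBelow 0 le_rfl
  have hle := hc x
  rw [shiftedPotential, hbot, EReal.bot_sub] at hle
  exact EReal.coe_ne_bot _ (le_bot_iff.1 hle)

theorem kernel_add_nonneg (h : IsAdmissible ω g V θ) (x z : X) :
    0 ≤ g x z + ((θ x + θ z : ℝ) : EReal) := by
  calc (0 : EReal) = -((θ x + θ z : ℝ) : EReal) + ((θ x + θ z : ℝ) : EReal) := by
        rw [← EReal.coe_neg, ← EReal.coe_add, neg_add_cancel, EReal.coe_zero]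
    _ ≤ _ := add_le_add_left (EReal.neg_le.1 (h.neg_kernel_le x z)) _

theorem coe_weightedKernel (h : IsAdmissible ω g V θ) (x z : X) :
    (weightedKernel g θ x z : EReal) = g x z + ((θ x + θ z : ℝ) : EReal) :=
  EReal.coe_toENNReal (h.kernel_add_nonneg x z)

theorem kernel_eq (h : IsAdmissible ω g V θ) (x z : X) :
    g x z = (weightedKernel g θ x z : EReal) - ((θ x + θ z : ℝ) : EReal) := by
  rw [h.coe_weightedKernel, EReal.add_sub_cancel_right]

theorem weightedKernel_comm (h : IsAdmissible ω g V θ) (x z : X) :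
    weightedKernel g θ x z = weightedKernel g θ z x := by
  rw [weightedKernel, weightedKernel, h.symm x z, add_comm (θ x)]

theorem weightedKernel_eq_top_iff (h : IsAdmissible ω g V θ) (x z : X) :
    weightedKernel g θ x z = ∞ ↔ g x z = ⊤ := by
  rw [← EReal.coe_ennreal_eq_top_iff, h.coe_weightedKernel]
  induction hg : g x z with
  | bot => exact absurd hg (h.kernel_ne_bot x z)
  | top => simp
  | coe a => simp [← EReal.coe_add]

theorem toReal_kernel (h : IsAdmissible ω g V θ) {x z : X} (hg : g x z ≠ ⊤) :
    (g x z).toReal = (weightedKernel g θ x z).toReal - (θ x + θ z) := by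
  have hfin : weightedKernel g θ x z ≠ ∞ := mt (h.weightedKernel_eq_top_iff x z).1 hg
  rw [h.kernel_eq x z, EReal.toReal_sub (by simpa using hfin) (EReal.coe_ennreal_ne_bot _)
    (EReal.coe_ne_top _) (EReal.coe_ne_bot _), EReal.toReal_coe_ennreal, EReal.toReal_coe]

theorem lowerSemicontinuous_weightedKernel (h : IsAdmissible ω g V θ) :
    LowerSemicontinuous fun q : X × X => weightedKernel g θ q.1 q.2 := by
  have hcont := h.theta_continuous
  have hsum : LowerSemicontinuous fun q : X × X =>
      g q.1 q.2 + ((θ q.1 + θ q.2 : ℝ) : EReal) :=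
    h.lsc.add' (continuous_coe_real_ereal.comp (by fun_prop)).lowerSemicontinuous fun q =>
      EReal.continuousAt_add (Or.inr (EReal.coe_ne_bot _)) (Or.inr (EReal.coe_ne_top _))
  simp only [← h.coe_weightedKernel] at hsum
  intro q a ha
  filter_upwards [hsum q (a : EReal) (EReal.coe_ennreal_lt_coe_ennreal_iff.2 ha)] with q' hq'
  exact EReal.coe_ennreal_lt_coe_ennreal_iff.1 hq'

theorem lintegral_weight_lt_top (h : IsAdmissible ω g V θ) {κ : ℝ} (hκ : 0 ≤ κ) :
    ∫⁻ x, EReal.exp (-V x) * ENNReal.ofReal (Real.exp (κ * θ x)) ∂ω < ∞ := by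
  simp_rw [← exp_neg_shiftedPotential]
  exact h.lintegral_lt_top κ hκ

theorem exists_weight_le (h : IsAdmissible ω g V θ) {κ : ℝ} (hκ : 0 ≤ κ) :
    ∃ B : ℝ≥0, ∀ x, EReal.exp (-shiftedPotential V θ κ x) ≤ B := by
  obtain ⟨c, hc⟩ := h.bddBelow κ hκ
  refine ⟨(Real.exp (-c)).toNNReal, fun x => ?_⟩
  change _ ≤ ENNReal.ofReal (Real.exp (-c))
  rw [← EReal.exp_coe, EReal.exp_le_exp_iff, EReal.coe_neg]
  exact EReal.neg_le_neg_iff.2 (hc x)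

theorem normalization_ne_zero (h : IsAdmissible ω g V θ) {κ : ℝ} (hκ : 0 ≤ κ) :
    ∫⁻ x, EReal.exp (-shiftedPotential V θ κ x) ∂ω ≠ 0 := by
  refine ((pos_iff_ne_zero.2 h.lintegral_ne_zero).trans_le (lintegral_mono fun x => ?_)).ne'
  rw [exp_neg_shiftedPotential]
  refine le_mul_of_one_le_right' (ENNReal.one_le_ofReal.2 (Real.one_le_exp ?_))
  exact mul_nonneg hκ (h.theta_nonneg x)

theorem isProbabilityMeasure_referenceMeasure (h : IsAdmissible ω g V θ) {κ : ℝ} (hκ : 0 ≤ κ) :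
    IsProbabilityMeasure (referenceMeasure ω V θ κ) := by
  constructor
  rw [referenceMeasure, Measure.smul_apply, withDensity_apply _ MeasurableSet.univ,
    Measure.restrict_univ, smul_eq_mul]
  exact ENNReal.inv_mul_cancel (h.normalization_ne_zero hκ) (h.lintegral_lt_top κ hκ).ne

theorem exists_referenceMeasure_le_smul (h : IsAdmissible ω g V θ) {κ : ℝ} (hκ : 0 ≤ κ) :
    ∃ D : ℝ≥0, referenceMeasure ω V θ κ ≤ D • ω := by
  obtain ⟨B, hB⟩ := h.exists_weight_le hκ
  refine ⟨(∫⁻ x, EReal.exp (-shiftedPotential V θ κ x) ∂ω)⁻¹.toNNReal * B, ?_⟩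
  have hle : ω.withDensity (fun x => EReal.exp (-shiftedPotential V θ κ x)) ≤ B • ω :=
    (withDensity_mono (ae_of_all _ hB)).trans_eq (withDensity_const (B : ℝ≥0∞))
  refine Measure.le_iff.2 fun s hs => ?_
  rw [referenceMeasure, Measure.smul_apply, smul_eq_mul]
  refine (mul_le_mul_right (Measure.le_iff.1 hle s hs) _).trans_eq ?_
  rw [Measure.smul_apply, Measure.smul_apply, ENNReal.smul_def, ENNReal.smul_def, ENNReal.coe_mul,
    ENNReal.coe_toNNReal (ENNReal.inv_ne_top.2 (h.normalization_ne_zero hκ)), smul_eq_mul,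
    smul_eq_mul, mul_assoc]

theorem lintegral_theta_ne_top (h : IsAdmissible ω g V θ) {ρ : Measure X} (hθ : Integrable θ ρ) :
    ∫⁻ x, ENNReal.ofReal (θ x) ∂ρ ≠ ∞ :=
  ((hasFiniteIntegral_iff_ofReal (ae_of_all _ h.theta_nonneg)).1 hθ.2).ne

variable [BorelSpace X]

theorem measurable_theta (h : IsAdmissible ω g V θ) : Measurable θ :=
  h.theta_continuous.measurable

theorem measurable_weight (h : IsAdmissible ω g V θ) (κ : ℝ) :
    Measurable fun x => EReal.exp (-V x) * ENNReal.ofReal (Real.exp (κ * θ x)) :=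
  h.measurable_potential.neg.ereal_exp.mul
    (h.measurable_theta.const_mul κ).exp.ennreal_ofReal

theorem lintegral_referenceMeasure (h : IsAdmissible ω g V θ) {κ : ℝ} {f : X → ℝ≥0∞}
    (hf : Measurable f) :
    ∫⁻ x, f x ∂(referenceMeasure ω V θ κ) =
      (∫⁻ x, EReal.exp (-shiftedPotential V θ κ x) ∂ω)⁻¹ *
        ∫⁻ x, EReal.exp (-V x) * ENNReal.ofReal (Real.exp (κ * θ x)) * f x ∂ω := by
  rw [referenceMeasure, lintegral_smul_measure, smul_eq_mul]
  simp_rw [exp_neg_shiftedPotential]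
  rw [lintegral_withDensity_eq_lintegral_mul _ (h.measurable_weight κ) hf]
  rfl

theorem lintegral_exp_theta_referenceMeasure_lt_top (h : IsAdmissible ω g V θ) {κ a : ℝ}
    (hκ : 0 ≤ κ) (ha : 0 ≤ a) :
    ∫⁻ x, ENNReal.ofReal (Real.exp (a * θ x)) ∂(referenceMeasure ω V θ κ) < ∞ := by
  rw [h.lintegral_referenceMeasure (h.measurable_theta.const_mul a).exp.ennreal_ofReal]
  refine ENNReal.mul_lt_top
    (ENNReal.inv_lt_top.2 (pos_iff_ne_zero.2 (h.normalization_ne_zero hκ))) ?_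
  refine lt_of_le_of_lt (le_of_eq (lintegral_congr fun x => ?_))
    (h.lintegral_weight_lt_top (add_nonneg hκ ha))
  rw [mul_assoc, ← ENNReal.ofReal_mul (Real.exp_pos _).le, ← Real.exp_add, add_mul]

theorem integrable_theta_of_klDiv_ne_top (h : IsAdmissible ω g V θ) {κ : ℝ} (hκ : 0 ≤ κ)
    {ρ : Measure X} [IsProbabilityMeasure ρ] (hkl : klDiv ρ (referenceMeasure ω V θ κ) ≠ ∞) :
    Integrable θ ρ := by
  have := h.isProbabilityMeasure_referenceMeasure hκ
  exact integrable_of_klDiv_ne_top hkl h.measurable_theta h.theta_nonneg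
    (by simpa using h.lintegral_exp_theta_referenceMeasure_lt_top hκ zero_le_one)

theorem integrable_theta_referenceMeasure (h : IsAdmissible ω g V θ) {κ : ℝ} (hκ : 0 ≤ κ) :
    Integrable θ (referenceMeasure ω V θ κ) := by
  have := h.isProbabilityMeasure_referenceMeasure hκ
  exact h.integrable_theta_of_klDiv_ne_top hκ (by simp)

variable [SecondCountableTopology X]

theorem measurable_weightedKernel (h : IsAdmissible ω g V θ) :
    Measurable fun q : X × X => weightedKernel g θ q.1 q.2 :=
  h.lowerSemicontinuous_weightedKernel.measurable

theorem measurable_kernel (h : IsAdmissible ω g V θ) :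
    Measurable fun q : X × X => g q.1 q.2 :=
  h.lsc.measurable

variable {ρ : Measure X} [IsProbabilityMeasure ρ] {D : ℝ≥0}

theorem exists_splitting (h : IsAdmissible ω g V θ) (hρ : ρ ≤ D • ω) {ε : ℝ≥0∞} (hε : ε ≠ 0) :
    ∃ (k : ℝ) (gc : X → X → ℝ) (gs : X → X → ℝ≥0∞),
      (∀ u x, g u x = (gc u x : EReal) + (gs u x : EReal)) ∧ (∀ u x, gc u x ≤ k) ∧
      Continuous (fun q : X × X => gc q.1 q.2) ∧ (∀ u, Measurable (gs u)) ∧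
      ∀ u, ∫⁻ x, gs u x ∂ρ ≤ ε := by
  obtain ⟨p, hp, hdecomp⟩ := h.decomposition
  have hp_pos : 0 < p := zero_lt_one.trans_le hp
  obtain ⟨k, gc, gs, hdec, hle, hcont, hint⟩ := hdecomp (ε ^ p / D)
    (ENNReal.div_ne_zero.2 ⟨by simp [ENNReal.rpow_eq_zero_iff, hε, hp_pos.not_gt],
      ENNReal.coe_ne_top⟩)
  have hmeas (u : X) : Measurable (gs u) := by
    have hgs : gs u = fun x => (g u x - (gc u x : EReal)).toENNReal := by
      ext x
      rw [hdec, add_comm, EReal.add_sub_cancel_right, EReal.toENNReal_coe]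
    rw [hgs]
    exact ((h.measurable_kernel.comp measurable_prodMk_left).sub
      (hcont.measurable.comp measurable_prodMk_left).coe_real_ereal).ereal_toENNReal
  refine ⟨k, gc, gs, hdec, hle, hcont, hmeas, fun u => ?_⟩
  have hpow : ∫⁻ x, gs u x ^ p ∂ρ ≤ ε ^ p := by
    refine (lintegral_mono' hρ le_rfl).trans ?_
    rw [lintegral_smul_measure]
    exact (mul_le_mul_right (hint u) _).trans ENNReal.mul_div_le
  have hnorm : eLpNorm (gs u) 1 ρ ≤ eLpNorm (gs u) (ENNReal.ofReal p) ρ :=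
    eLpNorm_le_eLpNorm_of_exponent_le (by simpa using hp) (hmeas u).aestronglyMeasurable
  rw [eLpNorm_one_eq_lintegral_enorm,
    eLpNorm_eq_lintegral_rpow_enorm_toReal (by simpa using hp_pos) ENNReal.ofReal_ne_top,
    ENNReal.toReal_ofReal hp_pos.le] at hnorm
  simp only [enorm_eq_self] at hnorm
  refine hnorm.trans ((ENNReal.rpow_le_rpow hpow (by positivity)).trans_eq ?_)
  rw [one_div, ENNReal.rpow_rpow_inv hp_pos.ne']

theorem exists_kernelPotential_le (h : IsAdmissible ω g V θ) (hρ : ρ ≤ D • ω) :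
    ∃ A : ℝ≥0, ∀ x, kernelPotential (weightedKernel g θ) ρ x ≤
      A + ENNReal.ofReal (θ x) + ∫⁻ z, ENNReal.ofReal (θ z) ∂ρ := by
  obtain ⟨k, gc, gs, hdec, hle, -, hmeas, hint⟩ := h.exists_splitting hρ one_ne_zero
  refine ⟨k.toNNReal + 1, fun x => ?_⟩
  have hpointwise (z : X) : weightedKernel g θ x z ≤
      (ENNReal.ofReal k + ENNReal.ofReal (θ x) + ENNReal.ofReal (θ z)) + gs x z := by
    rw [weightedKernel, hdec, add_right_comm, ← EReal.coe_add]
    refine EReal.toENNReal_add_le.trans ?_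
    rw [EReal.toENNReal_coe, EReal.toENNReal_of_ne_top (EReal.coe_ne_top _), EReal.toReal_coe]
    gcongr
    refine (ENNReal.ofReal_le_ofReal ?_).trans ((ENNReal.ofReal_add_le (p := k + θ x)).trans
      (add_le_add_left ENNReal.ofReal_add_le _))
    linarith [hle x z]
  calc kernelPotential (weightedKernel g θ) ρ x
      ≤ ∫⁻ z, (ENNReal.ofReal k + ENNReal.ofReal (θ x) + ENNReal.ofReal (θ z)) + gs x z ∂ρ :=
        lintegral_mono hpointwise
    _ = ENNReal.ofReal k + ENNReal.ofReal (θ x) + ∫⁻ z, ENNReal.ofReal (θ z) ∂ρ +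
          ∫⁻ z, gs x z ∂ρ := by
        rw [lintegral_add_right _ (hmeas x),
          lintegral_add_right _ h.measurable_theta.ennreal_ofReal, lintegral_const, measure_univ,
          mul_one]
    _ ≤ ENNReal.ofReal k + ENNReal.ofReal (θ x) + ∫⁻ z, ENNReal.ofReal (θ z) ∂ρ + 1 :=
        add_le_add_right (hint x) _
    _ = _ := by
        rw [ENNReal.coe_add, ENNReal.coe_one, ENNReal.ofReal]
        ring

theorem kernelPotential_ne_top (h : IsAdmissible ω g V θ) (hρ : ρ ≤ D • ω)
    (hθ : Integrable θ ρ) (x : X) : kernelPotential (weightedKernel g θ) ρ x ≠ ∞ := by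
  obtain ⟨A, hA⟩ := h.exists_kernelPotential_le hρ
  have hθ_lintegral := h.lintegral_theta_ne_top hθ
  exact ne_top_of_le_ne_top (by finiteness) (hA x)

theorem lintegral_kernelPotential_ne_top (h : IsAdmissible ω g V θ) (hρ : ρ ≤ D • ω)
    (hθ : Integrable θ ρ) {σ : Measure X} [IsProbabilityMeasure σ] (hθσ : Integrable θ σ) :
    ∫⁻ x, kernelPotential (weightedKernel g θ) ρ x ∂σ ≠ ∞ := by
  obtain ⟨A, hA⟩ := h.exists_kernelPotential_le hρ
  refine ne_top_of_le_ne_top ?_ (lintegral_mono hA)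
  rw [lintegral_add_right _ measurable_const, lintegral_add_left measurable_const]
  simp [h.lintegral_theta_ne_top hθ, h.lintegral_theta_ne_top hθσ]

end IsAdmissible

theorem Assumptions.measurable_potential {M : Type*} [MetricSpace M] [MeasurableSpace M]
    [BorelSpace M] {n : ℕ} {ω : Measure M} {g : M → M → EReal} {V : M → EReal} {θ : M → ℝ}
    (h : Assumptions n ω g V θ) : Measurable V := by
  classical
  have hV : shiftedPotential V θ 0 = V := by
    ext x
    simp [shiftedPotential]
  have hconf := h.confining 0 le_rfl
  rw [hV] at hconf
  have hpiecewise : {x | V x < ⊤}.piecewise V (fun _ => ⊤) = V := by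
    ext x
    by_cases hx : x ∈ {x | V x < ⊤}
    · exact Set.piecewise_eq_of_mem _ _ _ hx
    · rw [Set.piecewise_eq_of_notMem _ _ _ hx]
      exact (not_lt_top_iff.1 hx).symm
  rw [← hpiecewise]
  exact hconf.continuousOn.measurable_piecewise continuousOn_const hconf.isOpen.measurableSet

theorem Assumptions.isAdmissible {M : Type*} [MetricSpace M] [MeasurableSpace M] [BorelSpace M]
    {n : ℕ} {ω : Measure M} {g : M → M → EReal} {V : M → EReal} {θ : M → ℝ}
    (h : Assumptions n ω g V θ) (hω : ∫⁻ x, EReal.exp (-V x) ∂ω ≠ 0) :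
    IsAdmissible ω g V θ where
  symm := h.symm
  lsc := h.lsc
  decomposition := by
    obtain ⟨gc, gs, p, c, hp, hc, hk⟩ := h.decomposition
    refine ⟨p, hp.le, fun ε hε => ?_⟩
    obtain ⟨k, hk_one, hkε⟩ := ((eventually_ge_atTop 1).and
      ((ENNReal.tendsto_coe.2 hc).eventually_lt_const (pos_iff_ne_zero.2 hε))).exists
    obtain ⟨hdec, hle, hcont, hint⟩ := hk k hk_one
    exact ⟨k, gc k, gs k, hdec, hle, hcont, fun u => (hint u).trans hkε.le⟩
  theta_continuous := h.theta_continuous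
  theta_nonneg := h.theta_nonneg
  neg_kernel_le := h.neg_kernel_le
  measurable_potential := h.measurable_potential
  bddBelow κ hκ := (h.confining κ hκ).bddBelow
  lintegral_lt_top κ hκ := (h.confining κ hκ).integrable
  lintegral_ne_zero := hω

end Admissible

section Semicontinuity

variable {X : Type*} [TopologicalSpace X]

theorem lowerSemicontinuous_toReal {f : X → ℝ≥0∞} (hf : LowerSemicontinuous f)
    (hfin : ∀ x, f x ≠ ∞) : LowerSemicontinuous fun x => (f x).toReal := by
  intro x y hy
  rcases lt_or_ge y 0 with hneg | hnonneg
  · exact Eventually.of_forall fun _ => hneg.trans_le ENNReal.toReal_nonneg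
  · filter_upwards [hf x _ ((ENNReal.ofReal_lt_iff_lt_toReal hnonneg (hfin x)).2 hy)] with x' hx'
    exact (ENNReal.ofReal_lt_iff_lt_toReal hnonneg (hfin x')).1 hx'

theorem upperSemicontinuous_integral [FirstCountableTopology X] {Y : Type*} [MeasurableSpace Y]
    {μ : Measure Y} [IsFiniteMeasure μ] {f : X → Y → ℝ} {k : ℝ}
    (hm : ∀ x, Measurable (f x)) (hf : ∀ y, Continuous fun x => f x y)
    (hle : ∀ x y, f x y ≤ k) (hint : ∀ x, Integrable (f x) μ) :
    UpperSemicontinuous fun x => ∫ y, f x y ∂μ := by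
  have hint_sub (x : X) : Integrable (fun y => k - f x y) μ := (integrable_const k).sub (hint x)
  have hnonneg (x : X) (y : Y) : 0 ≤ k - f x y := sub_nonneg.2 (hle x y)
  have hlsc : LowerSemicontinuous fun x => ∫⁻ y, ENNReal.ofReal (k - f x y) ∂μ :=
    lowerSemicontinuous_lintegral (fun x => ((hm x).const_sub k).ennreal_ofReal) fun y =>
      (ENNReal.continuous_ofReal.comp (continuous_const.sub (hf y))).lowerSemicontinuous
  have hlsc_real := lowerSemicontinuous_toReal hlsc fun x => by
    rw [← ofReal_integral_eq_lintegral_ofReal (hint_sub x) (ae_of_all _ (hnonneg x))]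
    exact ENNReal.ofReal_ne_top
  intro x y hy
  have heq (x : X) : (∫⁻ y, ENNReal.ofReal (k - f x y) ∂μ).toReal =
      μ.real Set.univ * k - ∫ y, f x y ∂μ := by
    rw [← ofReal_integral_eq_lintegral_ofReal (hint_sub x) (ae_of_all _ (hnonneg x)),
      ENNReal.toReal_ofReal (integral_nonneg (hnonneg x)),
      integral_sub (integrable_const k) (hint x), integral_const, smul_eq_mul]
  have hlt : μ.real Set.univ * k - y < (∫⁻ z, ENNReal.ofReal (k - f x z) ∂μ).toReal := by
    rw [heq]
    exact sub_lt_sub_left hy _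
  filter_upwards [hlsc_real x _ hlt] with x' hx'
  rw [heq] at hx'
  linarith

end Semicontinuity

section Potential

variable {X : Type*} [TopologicalSpace X] [MeasurableSpace X] [BorelSpace X]
  [SecondCountableTopology X] {ω : Measure X} {g : X → X → EReal} {V : X → EReal}
  {θ : X → ℝ} {ρ : Measure X} [IsProbabilityMeasure ρ] {D : ℝ≥0}

namespace IsAdmissible

theorem measurable_weightedKernel_right (h : IsAdmissible ω g V θ) (x : X) :
    Measurable (weightedKernel g θ x) :=
  h.measurable_weightedKernel.comp measurable_prodMk_left

theorem ae_kernel_ne_top (h : IsAdmissible ω g V θ) (hρ : ρ ≤ D • ω) (hθ : Integrable θ ρ)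
    (x : X) : ∀ᵐ z ∂ρ, g x z ≠ ⊤ := by
  filter_upwards [ae_lt_top (h.measurable_weightedKernel_right x)
    (h.kernelPotential_ne_top hρ hθ x)] with z hz hg
  exact hz.ne ((h.weightedKernel_eq_top_iff x z).2 hg)

theorem toReal_kernel_ae_eq (h : IsAdmissible ω g V θ) (hρ : ρ ≤ D • ω) (hθ : Integrable θ ρ)
    (x : X) : (fun z => (g x z).toReal) =ᵐ[ρ]
      fun z => (weightedKernel g θ x z).toReal - (θ x + θ z) := by
  filter_upwards [h.ae_kernel_ne_top hρ hθ x] with z hz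
  exact h.toReal_kernel hz

theorem integrable_toReal_weightedKernel (h : IsAdmissible ω g V θ) (hρ : ρ ≤ D • ω)
    (hθ : Integrable θ ρ) (x : X) : Integrable (fun z => (weightedKernel g θ x z).toReal) ρ :=
  integrable_toReal_of_lintegral_ne_top (h.measurable_weightedKernel_right x).aemeasurable
    (h.kernelPotential_ne_top hρ hθ x)

theorem integrable_kernel (h : IsAdmissible ω g V θ) (hρ : ρ ≤ D • ω) (hθ : Integrable θ ρ)
    (x : X) : Integrable (fun z => (g x z).toReal) ρ :=
  (integrable_congr (h.toReal_kernel_ae_eq hρ hθ x)).2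
    ((h.integrable_toReal_weightedKernel hρ hθ x).sub ((integrable_const _).add hθ))

theorem potential_eq (h : IsAdmissible ω g V θ) (hρ : ρ ≤ D • ω) (hθ : Integrable θ ρ) (x : X) :
    potential g ρ x =
      (kernelPotential (weightedKernel g θ) ρ x).toReal - θ x - ∫ z, θ z ∂ρ := by
  have hθ_add : Integrable (fun z => θ x + θ z) ρ := (integrable_const _).add hθ
  have hm := h.measurable_weightedKernel_right x
  rw [potential, integral_congr_ae (h.toReal_kernel_ae_eq hρ hθ x),
    integral_sub (h.integrable_toReal_weightedKernel hρ hθ x) hθ_add,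
    integral_add (integrable_const _) hθ,
    integral_toReal hm.aemeasurable (ae_lt_top hm (h.kernelPotential_ne_top hρ hθ x)),
    integral_const, probReal_univ, one_smul, kernelPotential]
  ring

theorem lowerSemicontinuous_potential (h : IsAdmissible ω g V θ) (hρ : ρ ≤ D • ω)
    (hθ : Integrable θ ρ) : LowerSemicontinuous (potential g ρ) := by
  have hlsc : LowerSemicontinuous (kernelPotential (weightedKernel g θ) ρ) :=
    lowerSemicontinuous_lintegral h.measurable_weightedKernel_right fun z =>
      h.lowerSemicontinuous_weightedKernel.comp (Continuous.prodMk_left z)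
  have hcont : Continuous fun x => -θ x - ∫ z, θ z ∂ρ :=
    h.theta_continuous.neg.sub continuous_const
  have heq : potential g ρ = fun x =>
      (kernelPotential (weightedKernel g θ) ρ x).toReal + (-θ x - ∫ z, θ z ∂ρ) := by
    ext x
    rw [h.potential_eq hρ hθ]
    ring
  rw [heq]
  exact (lowerSemicontinuous_toReal hlsc (h.kernelPotential_ne_top hρ hθ)).add
    hcont.lowerSemicontinuous

theorem upperSemicontinuous_potential (h : IsAdmissible ω g V θ) (hρ : ρ ≤ D • ω)
    (hθ : Integrable θ ρ) : UpperSemicontinuous (potential g ρ) := by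
  intro x y hy
  set ε : ℝ := y - potential g ρ x
  have hε_pos : 0 < ε := sub_pos.2 hy
  obtain ⟨k, gc, gs, hdec, hle, hcont, hmeas, hgs⟩ :=
    h.exists_splitting hρ (ENNReal.ofReal_pos.2 (half_pos hε_pos)).ne'
  have hgs_ne_top (u : X) : ∫⁻ z, gs u z ∂ρ ≠ ∞ :=
    ne_top_of_le_ne_top ENNReal.ofReal_ne_top (hgs u)
  have hgs_int (u : X) : Integrable (fun z => (gs u z).toReal) ρ :=
    integrable_toReal_of_lintegral_ne_top (hmeas u).aemeasurable (hgs_ne_top u)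
  have hgc_ae (u : X) : gc u =ᵐ[ρ] fun z => (g u z).toReal - (gs u z).toReal := by
    filter_upwards [ae_lt_top (hmeas u) (hgs_ne_top u)] with z hz
    rw [hdec, EReal.toReal_add (EReal.coe_ne_top _) (EReal.coe_ne_bot _) (by simpa using hz.ne)
      (EReal.coe_ennreal_ne_bot _), EReal.toReal_coe, EReal.toReal_coe_ennreal,
      add_sub_cancel_right]
  have hgc_int (u : X) : Integrable (gc u) ρ :=
    (integrable_congr (hgc_ae u)).2 ((h.integrable_kernel hρ hθ u).sub (hgs_int u))
  have hpotential (u : X) :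
      potential g ρ u = ∫ z, gc u z ∂ρ + ∫ z, (gs u z).toReal ∂ρ := by
    rw [integral_congr_ae (hgc_ae u), integral_sub (h.integrable_kernel hρ hθ u) (hgs_int u),
      sub_add_cancel, potential]
  have hgs_nonneg (u : X) : 0 ≤ ∫ z, (gs u z).toReal ∂ρ :=
    integral_nonneg fun _ => ENNReal.toReal_nonneg
  have hgs_le (u : X) : ∫ z, (gs u z).toReal ∂ρ ≤ ε / 2 := by
    rw [integral_toReal (hmeas u).aemeasurable (ae_lt_top (hmeas u) (hgs_ne_top u))]
    exact ENNReal.toReal_le_of_le_ofReal (half_pos hε_pos).le (hgs u)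
  have husc : UpperSemicontinuous fun u => ∫ z, gc u z ∂ρ :=
    upperSemicontinuous_integral (fun u => hcont.measurable.comp measurable_prodMk_left)
      (fun z => hcont.comp (Continuous.prodMk_left z)) hle hgc_int
  filter_upwards [husc x (y - ε / 2) (by linarith [hpotential x, hgs_nonneg x])] with u hu
  linarith [hpotential u, hgs_le u]

theorem continuous_potential (h : IsAdmissible ω g V θ) (hρ : ρ ≤ D • ω) (hθ : Integrable θ ρ) :
    Continuous (potential g ρ) :=
  continuous_iff_lower_upperSemicontinuous.2
    ⟨h.lowerSemicontinuous_potential hρ hθ, h.upperSemicontinuous_potential hρ hθ⟩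

theorem integrable_toReal_kernelPotential (h : IsAdmissible ω g V θ) (hρ : ρ ≤ D • ω)
    (hθ : Integrable θ ρ) :
    Integrable (fun x => (kernelPotential (weightedKernel g θ) ρ x).toReal) ρ :=
  integrable_toReal_of_lintegral_ne_top
    (measurable_kernelPotential h.measurable_weightedKernel ρ).aemeasurable
    (h.lintegral_kernelPotential_ne_top hρ hθ hθ)

theorem integrable_potential (h : IsAdmissible ω g V θ) (hρ : ρ ≤ D • ω) (hθ : Integrable θ ρ) :
    Integrable (potential g ρ) ρ := by
  rw [funext (h.potential_eq hρ hθ)]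
  exact ((h.integrable_toReal_kernelPotential hρ hθ).sub hθ).sub (integrable_const _)

theorem integral_potential (h : IsAdmissible ω g V θ) (hρ : ρ ≤ D • ω) (hθ : Integrable θ ρ) :
    ∫ x, potential g ρ x ∂ρ = (weightedEnergy g θ ρ).toReal - 2 * ∫ z, θ z ∂ρ := by
  have hint := h.integrable_toReal_kernelPotential hρ hθ
  have hint_sub : Integrable
      (fun x => (kernelPotential (weightedKernel g θ) ρ x).toReal - θ x) ρ := hint.sub hθ
  simp_rw [h.potential_eq hρ hθ]
  rw [integral_sub hint_sub (integrable_const _), integral_sub hint hθ,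
    integral_toReal (measurable_kernelPotential h.measurable_weightedKernel ρ).aemeasurable
      (ae_of_all _ fun x => (h.kernelPotential_ne_top hρ hθ x).lt_top),
    integral_const, probReal_univ, one_smul]
  change (weightedEnergy g θ ρ).toReal - _ - _ = _
  ring

end IsAdmissible

end Potential

section Minimizer

theorem freeEnergy_eq_kernelEnergy_add_klDiv {X : Type*} [MeasurableSpace X]
    (ω : Measure X) (g : X → X → EReal) (V : X → EReal) (θ : X → ℝ) (γ : ℝ)
    (μ : ProbabilityMeasure X) :
    freeEnergy ω g V θ γ μ =
      kernelEnergy (fun x z => ENNReal.ofReal (γ / 2) * weightedKernel g θ x z) (μ : Measure X) +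
        klDiv (μ : Measure X) (referenceMeasure ω V θ γ) := by
  rw [kernelEnergy_const_mul ENNReal.ofReal_ne_top]
  rfl

variable {X : Type*} [TopologicalSpace X] [MeasurableSpace X] [BorelSpace X]
  {ω : Measure X} {g : X → X → EReal} {V : X → EReal}
  {θ : X → ℝ} {γ : ℝ}

namespace IsAdmissible

theorem tilted_referenceMeasure_eq_withDensity (h : IsAdmissible ω g V θ) (hγ : 0 ≤ γ)
    {f : X → ℝ} (hf : Measurable f) {L : ℝ}
    (hL : L = (∫⁻ x, EReal.exp (-shiftedPotential V θ γ x) ∂ω).toReal *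
      ∫ x, Real.exp (f x) ∂(referenceMeasure ω V θ γ)) :
    (referenceMeasure ω V θ γ).tilted f = ω.withDensity fun x =>
      ENNReal.ofReal L⁻¹ * EReal.exp (((γ * θ x + f x : ℝ) : EReal) - V x) := by
  set C := ∫⁻ x, EReal.exp (-shiftedPotential V θ γ x) ∂ω with hC
  set Z := ∫ x, Real.exp (f x) ∂(referenceMeasure ω V θ γ) with hZ
  have hdensity : Measurable fun x => ENNReal.ofReal (Real.exp (f x) / Z) :=
    (hf.exp.div_const Z).ennreal_ofReal
  have hreference : referenceMeasure ω V θ γ = C⁻¹ • ω.withDensity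
      fun x => EReal.exp (-V x) * ENNReal.ofReal (Real.exp (γ * θ x)) := by
    simp only [referenceMeasure, hC, exp_neg_shiftedPotential]
  have hC_inv : C⁻¹ = ENNReal.ofReal C.toReal⁻¹ := by
    have hC_ne_top := (h.lintegral_lt_top γ hγ).ne
    rw [ENNReal.ofReal_inv_of_pos (ENNReal.toReal_pos (h.normalization_ne_zero hγ) hC_ne_top),
      ENNReal.ofReal_toReal hC_ne_top]
  rw [Measure.tilted, ← hZ, hreference, withDensity_smul_measure,
    ← withDensity_mul _ (h.measurable_weight γ) hdensity,
    ← withDensity_smul _ ((h.measurable_weight γ).mul hdensity)]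
  congr 1
  ext x
  have hreal : L⁻¹ * Real.exp (γ * θ x + f x) =
      C.toReal⁻¹ * (Real.exp (γ * θ x) * (Real.exp (f x) / Z)) := by
    rw [hL, Real.exp_add, mul_inv, div_eq_mul_inv]
    ring
  have hZ_nonneg : 0 ≤ Z := integral_nonneg fun _ => (Real.exp_pos _).le
  have hL_nonneg : 0 ≤ L := hL ▸ mul_nonneg ENNReal.toReal_nonneg hZ_nonneg
  simp only [Pi.smul_apply, Pi.mul_apply, smul_eq_mul]
  rw [sub_eq_add_neg, EReal.exp_add, EReal.exp_coe, ← mul_assoc (ENNReal.ofReal L⁻¹),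
    ← ENNReal.ofReal_mul (by positivity), hreal, ENNReal.ofReal_mul (by positivity),
    ENNReal.ofReal_mul (by positivity), hC_inv]
  ring

variable [SecondCountableTopology X] {μ : ProbabilityMeasure X}

theorem kernelEnergy_referenceMeasure_ne_top (h : IsAdmissible ω g V θ) (hγ : 0 ≤ γ) :
    kernelEnergy (weightedKernel g θ) (referenceMeasure ω V θ γ) ≠ ∞ := by
  have := h.isProbabilityMeasure_referenceMeasure hγ
  obtain ⟨D, hD⟩ := h.exists_referenceMeasure_le_smul hγ
  have hθ := h.integrable_theta_referenceMeasure hγ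
  exact h.lintegral_kernelPotential_ne_top hD hθ hθ

theorem klDiv_minimizer_ne_top (h : IsAdmissible ω g V θ) (hγ : 0 ≤ γ)
    (hmin : ∀ ρ : ProbabilityMeasure X, freeEnergy ω g V θ γ μ ≤ freeEnergy ω g V θ γ ρ) :
    klDiv (μ : Measure X) (referenceMeasure ω V θ γ) ≠ ∞ := by
  have hν := h.isProbabilityMeasure_referenceMeasure hγ
  have hle := hmin ⟨referenceMeasure ω V θ γ, hν⟩
  have hfin : freeEnergy ω g V θ γ ⟨referenceMeasure ω V θ γ, hν⟩ ≠ ∞ := by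
    simp only [freeEnergy, ProbabilityMeasure.coe_mk, klDiv_self, add_zero]
    exact ENNReal.mul_ne_top ENNReal.ofReal_ne_top (h.kernelEnergy_referenceMeasure_ne_top hγ)
  exact (ENNReal.add_ne_top.1 (ne_top_of_le_ne_top hfin hle)).2

theorem integrable_theta_minimizer (h : IsAdmissible ω g V θ) (hγ : 0 ≤ γ)
    (hmin : ∀ ρ : ProbabilityMeasure X, freeEnergy ω g V θ γ μ ≤ freeEnergy ω g V θ γ ρ) :
    Integrable θ (μ : Measure X) :=
  h.integrable_theta_of_klDiv_ne_top hγ (h.klDiv_minimizer_ne_top hγ hmin)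

theorem minimizer_eq_tilted (h : IsAdmissible ω g V θ) (hγ : 0 ≤ γ)
    (hmin : ∀ ρ : ProbabilityMeasure X, freeEnergy ω g V θ γ μ ≤ freeEnergy ω g V θ γ ρ) :
    (μ : Measure X) = (referenceMeasure ω V θ γ).tilted fun x =>
      -γ * (kernelPotential (weightedKernel g θ) (μ : Measure X) x).toReal := by
  have := h.isProbabilityMeasure_referenceMeasure hγ
  obtain ⟨D, hD⟩ := h.exists_referenceMeasure_le_smul hγ
  have hm := h.measurable_weightedKernel
  have hPν : ∫⁻ x, kernelPotential (weightedKernel g θ) (μ : Measure X) x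
      ∂(referenceMeasure ω V θ γ) ≠ ∞ := by
    rw [lintegral_kernelPotential_comm hm h.weightedKernel_comm]
    exact h.lintegral_kernelPotential_ne_top hD (h.integrable_theta_referenceMeasure hγ)
      (h.integrable_theta_minimizer hγ hmin)
  have htilted := eq_tilted_of_forall_kernelEnergy_add_klDiv_le
    (K := fun x z => ENNReal.ofReal (γ / 2) * weightedKernel g θ x z) (μ := (μ : Measure X))
    (ν := referenceMeasure ω V θ γ) (hm.const_mul _)
    (fun x z => by rw [h.weightedKernel_comm])
    (fun ρ hρ => by
      rw [← freeEnergy_eq_kernelEnergy_add_klDiv]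
      exact (hmin ⟨ρ, hρ⟩).trans_eq (freeEnergy_eq_kernelEnergy_add_klDiv ω g V θ γ ⟨ρ, hρ⟩))
    (by
      rw [kernelEnergy_const_mul ENNReal.ofReal_ne_top]
      exact ENNReal.mul_ne_top ENNReal.ofReal_ne_top (h.kernelEnergy_referenceMeasure_ne_top hγ))
    (by
      simp_rw [kernelPotential_const_mul ENNReal.ofReal_ne_top]
      rw [lintegral_const_mul' _ _ ENNReal.ofReal_ne_top]
      exact ENNReal.mul_ne_top ENNReal.ofReal_ne_top hPν)
  convert htilted using 3 with x
  rw [kernelPotential_const_mul ENNReal.ofReal_ne_top, ENNReal.toReal_mul,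
    ENNReal.toReal_ofReal (by positivity)]
  ring

theorem exists_minimizer_le_smul (h : IsAdmissible ω g V θ) (hγ : 0 ≤ γ)
    (hmin : ∀ ρ : ProbabilityMeasure X, freeEnergy ω g V θ γ μ ≤ freeEnergy ω g V θ γ ρ) :
    ∃ D : ℝ≥0, (μ : Measure X) ≤ D • ω := by
  obtain ⟨D, hD⟩ := h.exists_referenceMeasure_le_smul hγ
  have hle := tilted_le_smul (ν := referenceMeasure ω V θ γ)
    (f := fun x => -γ * (kernelPotential (weightedKernel g θ) (μ : Measure X) x).toReal)
    fun x => mul_nonpos_of_nonpos_of_nonneg (neg_nonpos.2 hγ) ENNReal.toReal_nonneg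
  rw [← h.minimizer_eq_tilted hγ hmin] at hle
  set Z := ∫ x, Real.exp (-γ * (kernelPotential (weightedKernel g θ) (μ : Measure X) x).toReal)
    ∂(referenceMeasure ω V θ γ)
  refine ⟨Z⁻¹.toNNReal * D, hle.trans (Measure.le_iff.2 fun s hs => ?_)⟩
  rw [mul_smul, Measure.smul_apply, Measure.smul_apply _ (D • ω)]
  simp only [ENNReal.smul_def, smul_eq_mul]
  exact mul_le_mul_right (Measure.le_iff.1 hD s hs) _

theorem freeEnergy_minimizer (h : IsAdmissible ω g V θ) (hγ : 0 ≤ γ)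
    (hmin : ∀ ρ : ProbabilityMeasure X, freeEnergy ω g V θ γ μ ≤ freeEnergy ω g V θ γ ρ) :
    freeEnergy ω g V θ γ μ = ENNReal.ofReal
      (-(γ / 2) * (weightedEnergy g θ (μ : Measure X)).toReal - Real.log
        (∫ x, Real.exp (-γ * (kernelPotential (weightedKernel g θ) (μ : Measure X) x).toReal)
          ∂(referenceMeasure ω V θ γ))) := by
  have := h.isProbabilityMeasure_referenceMeasure hγ
  obtain ⟨D, hD⟩ := h.exists_minimizer_le_smul hγ hmin
  have hθ := h.integrable_theta_minimizer hγ hmin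
  have hPm := measurable_kernelPotential h.measurable_weightedKernel (μ : Measure X)
  have hE : weightedEnergy g θ (μ : Measure X) ≠ ∞ := h.lintegral_kernelPotential_ne_top hD hθ hθ
  have hkl := h.klDiv_minimizer_ne_top hγ hmin
  set f : X → ℝ := fun x =>
    -γ * (kernelPotential (weightedKernel g θ) (μ : Measure X) x).toReal
  have hμ : (μ : Measure X) = (referenceMeasure ω V θ γ).tilted f := h.minimizer_eq_tilted hγ hmin
  have hexp : Integrable (fun x => Real.exp (f x)) (referenceMeasure ω V θ γ) :=
    integrable_exp_of_nonpos (hPm.ennreal_toReal.const_mul _) fun x =>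
      mul_nonpos_of_nonpos_of_nonneg (neg_nonpos.2 hγ) ENNReal.toReal_nonneg
  have hf_int : Integrable f (μ : Measure X) :=
    (h.integrable_toReal_kernelPotential hD hθ).const_mul _
  have hf_integral : ∫ x, f x ∂(μ : Measure X) =
      -γ * (weightedEnergy g θ (μ : Measure X)).toReal := by
    rw [integral_const_mul, integral_toReal hPm.aemeasurable (ae_lt_top hPm hE)]
    rfl
  have hkl_eq : (klDiv (μ : Measure X) (referenceMeasure ω V θ γ)).toReal =
      ∫ x, f x ∂(μ : Measure X) - Real.log (∫ x, Real.exp (f x) ∂(referenceMeasure ω V θ γ)) := by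
    rw [hμ] at hf_int ⊢
    exact toReal_klDiv_tilted_left hexp hf_int
  rw [freeEnergy, ← ENNReal.ofReal_toReal hkl, ← ENNReal.ofReal_toReal hE,
    ← ENNReal.ofReal_mul (by positivity), ← ENNReal.ofReal_add (by positivity) (by positivity),
    hkl_eq, hf_integral, ENNReal.toReal_ofReal ENNReal.toReal_nonneg]
  congr 1
  ring

theorem exists_minimizer_eq_withDensity (h : IsAdmissible ω g V θ) (hγ : 0 ≤ γ)
    (hmin : ∀ ρ : ProbabilityMeasure X, freeEnergy ω g V θ γ μ ≤ freeEnergy ω g V θ γ ρ) :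
    ∃ L : ℝ, 0 < L ∧ ((μ : Measure X) = ω.withDensity fun x => ENNReal.ofReal L⁻¹ *
        EReal.exp (-(((γ * potential g (μ : Measure X) x : ℝ) : EReal) + V x))) ∧
      freeEnergy ω g V θ γ μ = ENNReal.ofReal
        (Real.log (∫⁻ x, EReal.exp (-shiftedPotential V θ γ x) ∂ω).toReal - Real.log L -
          γ / 2 * ∫ x, potential g (μ : Measure X) x ∂(μ : Measure X)) := by
  have := h.isProbabilityMeasure_referenceMeasure hγ
  obtain ⟨D, hD⟩ := h.exists_minimizer_le_smul hγ hmin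
  have hθ := h.integrable_theta_minimizer hγ hmin
  have hPm := measurable_kernelPotential h.measurable_weightedKernel (μ : Measure X)
  set C := ∫⁻ x, EReal.exp (-shiftedPotential V θ γ x) ∂ω
  set f : X → ℝ := fun x =>
    -γ * (kernelPotential (weightedKernel g θ) (μ : Measure X) x).toReal
  set Z := ∫ x, Real.exp (f x) ∂(referenceMeasure ω V θ γ)
  set τ := ∫ z, θ z ∂(μ : Measure X)
  have hf_meas : Measurable f := hPm.ennreal_toReal.const_mul _
  have hC_pos : 0 < C.toReal :=
    ENNReal.toReal_pos (h.normalization_ne_zero hγ) (h.lintegral_lt_top γ hγ).ne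
  have hZ_pos : 0 < Z := integral_exp_pos <| integrable_exp_of_nonpos hf_meas fun x =>
    mul_nonpos_of_nonpos_of_nonneg (neg_nonpos.2 hγ) ENNReal.toReal_nonneg
  refine ⟨C.toReal * Z * Real.exp (γ * τ), by positivity, ?_, ?_⟩
  · have hexponent (x : X) :
        γ * θ x + f x = -(γ * potential g (μ : Measure X) x) + -(γ * τ) := by
      rw [h.potential_eq hD hθ]
      ring
    conv_lhs => rw [h.minimizer_eq_tilted hγ hmin,
      h.tilted_referenceMeasure_eq_withDensity hγ hf_meas rfl]
    congr 1
    ext x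
    rw [hexponent, EReal.neg_add (Or.inl (EReal.coe_ne_bot _)) (Or.inl (EReal.coe_ne_top _)),
      EReal.coe_add, sub_eq_add_neg, sub_eq_add_neg, add_right_comm, EReal.exp_add, EReal.exp_coe,
      Real.exp_neg, mul_inv (C.toReal * Z), ENNReal.ofReal_mul (p := (C.toReal * Z)⁻¹)
        (by positivity), ← EReal.coe_neg]
    ring
  · rw [h.freeEnergy_minimizer hγ hmin, h.integral_potential hD hθ,
      Real.log_mul (by positivity) (by positivity), Real.log_mul hC_pos.ne' hZ_pos.ne',
      Real.log_exp]
    congr 1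
    ring

end IsAdmissible

end Minimizer

section Configurations

theorem sum_ne_bot {ι : Type*} (s : Finset ι) {v : ι → EReal} (hv : ∀ i, v i ≠ ⊥) :
    ∑ i ∈ s, v i ≠ ⊥ :=
  Finset.sum_induction v (· ≠ ⊥) (fun _ _ ha hb => EReal.add_ne_bot_iff.2 ⟨ha, hb⟩)
    EReal.zero_ne_bot fun i _ => hv i

theorem exp_neg_sum {ι : Type*} (s : Finset ι) {v : ι → EReal} (hv : ∀ i, v i ≠ ⊥) :
    EReal.exp (-∑ i ∈ s, v i) = ∏ i ∈ s, EReal.exp (-v i) := by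
  classical
  induction s using Finset.induction_on with
  | empty => simp
  | insert a s ha ih =>
    rw [Finset.sum_insert ha, Finset.prod_insert ha, ← ih,
      EReal.neg_add (Or.inl (hv a)) (Or.inr (sum_ne_bot s hv)), sub_eq_add_neg, EReal.exp_add]

theorem coe_sum_ereal {ι : Type*} (s : Finset ι) (v : ι → ℝ) :
    ((∑ i ∈ s, v i : ℝ) : EReal) = ∑ i ∈ s, (v i : EReal) :=
  map_sum (⟨⟨Real.toEReal, EReal.coe_zero⟩, EReal.coe_add⟩ : ℝ →+ EReal) v s

theorem exp_neg_coe_add (r : ℝ) (a : EReal) :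
    EReal.exp (-((r : EReal) + a)) = ENNReal.ofReal (Real.exp (-r)) * EReal.exp (-a) := by
  rw [EReal.neg_add (Or.inl (EReal.coe_ne_bot _)) (Or.inl (EReal.coe_ne_top _)), sub_eq_add_neg,
    EReal.exp_add, ← EReal.coe_neg, EReal.exp_coe]

theorem sum_sum_Ioi_add {ι : Type*} [LinearOrder ι] [Fintype ι] [LocallyFiniteOrderTop ι]
    [LocallyFiniteOrderBot ι] (f : ι → ι → ℝ) :
    ∑ i, ∑ j ∈ Finset.Ioi i, (f i j + f j i) = ∑ i, ∑ j, f i j - ∑ i, f i i := by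
  have hcompl (i : ι) : ∑ j ∈ {i}ᶜ, f j i = ∑ j, f j i - f i i := by
    rw [← Finset.sum_add_sum_compl {i} fun j => f j i, Finset.sum_singleton, add_sub_cancel_left]
  calc ∑ i, ∑ j ∈ Finset.Ioi i, (f i j + f j i)
      = ∑ i, ∑ j ∈ Finset.Ioi i, (f j i + f i j) := by simp only [add_comm]
    _ = ∑ i, ∑ j ∈ {i}ᶜ, f j i := Finset.sum_sum_Ioi_add_eq_sum_sum_off_diag f
    _ = ∑ i, ∑ j, f i j - ∑ i, f i i := by
      simp only [hcompl, Finset.sum_sub_distrib]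
      rw [Finset.sum_comm]

theorem sum_sum_Ioi_const {N : ℕ} (c : ℝ) :
    ∑ i : Fin N, ∑ _j ∈ Finset.Ioi i, c = N * (N - 1) / 2 * c := by
  have hsum := sum_sum_Ioi_add (ι := Fin N) fun _ _ => c / 2
  simp only [add_halves, Finset.sum_const, Finset.card_univ, Fintype.card_fin, nsmul_eq_mul]
    at hsum ⊢
  rw [hsum]
  ring

variable {X : Type*} {g : X → X → EReal} {V : X → EReal} {N : ℕ} {β : ℝ}

theorem exp_neg_energy_le (hV : ∀ x, V x ≠ ⊥) (hβ : 0 ≤ β) (x : Fin N → X)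
    {r : Fin N → Fin N → ℝ} (hr : ∀ i j, (r i j : EReal) ≤ g (x i) (x j)) :
    EReal.exp (-energy β g V x) ≤
      ENNReal.ofReal (Real.exp (-(β * ∑ i, ∑ j ∈ Finset.Ioi i, r i j))) *
        ∏ j, EReal.exp (-V (x j)) := by
  rw [← exp_neg_sum _ fun j => hV (x j), ← exp_neg_coe_add, EReal.exp_le_exp_iff,
    EReal.neg_le_neg_iff, energy, EReal.coe_mul]
  refine add_le_add_left (mul_le_mul_of_nonneg_left ?_ (EReal.coe_nonneg.2 hβ)) _
  simp only [coe_sum_ereal]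
  exact Finset.sum_le_sum fun i _ => Finset.sum_le_sum fun j _ => hr i j

theorem exp_neg_energy_eq (hV : ∀ x, V x ≠ ⊥) (hg : ∀ x z, g x z ≠ ⊥) (x : Fin N → X)
    (hx : ∀ i j, i < j → g (x i) (x j) ≠ ⊤) :
    EReal.exp (-energy β g V x) =
      ENNReal.ofReal (Real.exp (-(β * ∑ i, ∑ j ∈ Finset.Ioi i, (g (x i) (x j)).toReal))) *
        ∏ j, EReal.exp (-V (x j)) := by
  rw [← exp_neg_sum _ fun j => hV (x j), ← exp_neg_coe_add, energy, EReal.coe_mul]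
  simp only [coe_sum_ereal]
  congr 4
  exact Finset.sum_congr rfl fun i _ => Finset.sum_congr rfl fun j hj =>
    (EReal.coe_toReal (hx i j (Finset.mem_Ioi.1 hj)) (hg _ _)).symm

variable [TopologicalSpace X] [MeasurableSpace X] {ω : Measure X} {θ : X → ℝ}

namespace IsAdmissible

theorem coe_sub_le_kernel (h : IsAdmissible ω g V θ) {u v : X} {a : ℝ} (ha : 0 ≤ a)
    (hK : ENNReal.ofReal a ≤ weightedKernel g θ u v) :
    ((a - (θ u + θ v) : ℝ) : EReal) ≤ g u v := by
  rw [h.kernel_eq u v, EReal.coe_sub]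
  refine EReal.sub_le_sub ?_ le_rfl
  rw [← EReal.coe_ennreal_le_coe_ennreal_iff] at hK
  rwa [EReal.coe_ennreal_ofReal, max_eq_left ha] at hK

/-- Half of the double sum is the sum over pairs up to the diagonal, which costs `β / 2 * N * b`. -/
theorem exp_neg_energy_le_of_le (h : IsAdmissible ω g V θ) (hβ : 0 ≤ β) {K : X × X → ℝ} {b : ℝ}
    (hK0 : ∀ q, 0 ≤ K q) (hKb : ∀ q, K q ≤ b)
    (hK : ∀ q, ENNReal.ofReal (K q) ≤ weightedKernel g θ q.1 q.2) (x : Fin N → X) :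
    EReal.exp (-energy β g V x) ≤
      ENNReal.ofReal (Real.exp (-(β / 2 * ∑ i, ∑ j, K (x i, x j)) + β / 2 * N * b +
        β * (N - 1) * ∑ i, θ (x i))) * ∏ j, EReal.exp (-V (x j)) := by
  have hkernel (i j : Fin N) :
      (((K (x i, x j) / 2 - θ (x i)) + (K (x j, x i) / 2 - θ (x j)) : ℝ) : EReal) ≤
        g (x i) (x j) := by
    have hij := h.coe_sub_le_kernel (hK0 _) (hK (x i, x j))
    have hji := h.coe_sub_le_kernel (hK0 _) (hK (x j, x i))
    rw [h.symm (x j) (x i)] at hji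
    rcases le_total (K (x i, x j)) (K (x j, x i)) with hle | hle
    · exact (EReal.coe_le_coe_iff.2 (by linarith)).trans hji
    · exact (EReal.coe_le_coe_iff.2 (by linarith)).trans hij
  have hdiag : ∑ i, K (x i, x i) ≤ N * b := by
    simpa using Finset.sum_le_sum fun i (_ : i ∈ Finset.univ) => hKb (x i, x i)
  refine (exp_neg_energy_le h.potential_ne_bot hβ x hkernel).trans
    (mul_le_mul_left (ENNReal.ofReal_le_ofReal (Real.exp_le_exp.2 ?_)) _)
  rw [sum_sum_Ioi_add fun i j => K (x i, x j) / 2 - θ (x i)]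
  simp only [Finset.sum_sub_distrib, Finset.sum_const, Finset.card_univ, Fintype.card_fin,
    nsmul_eq_mul, ← Finset.sum_div, ← Finset.mul_sum]
  linarith [mul_le_mul_of_nonneg_left hdiag hβ]

end IsAdmissible

end Configurations

section Jensen

theorem ofReal_exp_integral_le_lintegral {Ω : Type*} [MeasurableSpace Ω] {P : Measure Ω}
    [IsProbabilityMeasure P] {S : Ω → ℝ} (hS : Integrable S P) :
    ENNReal.ofReal (Real.exp (∫ x, S x ∂P)) ≤ ∫⁻ x, ENNReal.ofReal (Real.exp (S x)) ∂P := by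
  by_cases htop : ∫⁻ x, ENNReal.ofReal (Real.exp (S x)) ∂P = ∞
  · rw [htop]
    exact le_top
  have hexp : Integrable (fun x => Real.exp (S x)) P := (lintegral_ofReal_ne_top_iff_integrable
    (Real.continuous_exp.comp_aestronglyMeasurable hS.1)
    (ae_of_all _ fun x => (Real.exp_pos _).le)).1 htop
  rw [← ofReal_integral_eq_lintegral_ofReal hexp (ae_of_all _ fun x => (Real.exp_pos _).le)]
  exact ENNReal.ofReal_le_ofReal <| convexOn_exp.map_integral_le Real.continuous_exp.continuousOn
    isClosed_univ (ae_of_all _ fun _ => Set.mem_univ _) hS hexp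

end Jensen

section LowerBound

variable {X : Type*}

/-- The logarithm of the density of the Boltzmann weight `e^{-energy}` with respect to the `N`-th
power of the measure `L⁻¹ e^{-γ U - V} ω`, at configurations of finite energy. -/
def logDensity {N : ℕ} (g : X → X → EReal) (U : X → ℝ) (γ L β : ℝ) (x : Fin N → X) : ℝ :=
  -(β * ∑ i, ∑ j ∈ Finset.Ioi i, (g (x i) (x j)).toReal) + ∑ i, (γ * U (x i) + Real.log L)

theorem exp_neg_eq_mul_exp_log {L : ℝ} (hL : 0 < L) (r : ℝ) (a : EReal) :
    EReal.exp (-a) = ENNReal.ofReal L⁻¹ * EReal.exp (-((r : EReal) + a)) *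
      ENNReal.ofReal (Real.exp (r + Real.log L)) := by
  have hcancel : ENNReal.ofReal L⁻¹ * ENNReal.ofReal (Real.exp (-r)) *
      ENNReal.ofReal (Real.exp (r + Real.log L)) = 1 := by
    rw [← ENNReal.ofReal_mul (by positivity), ← ENNReal.ofReal_mul (by positivity),
      Real.exp_add, Real.exp_log hL, Real.exp_neg, ← ENNReal.ofReal_one]
    congr 1
    field_simp
  calc EReal.exp (-a) = ENNReal.ofReal L⁻¹ * ENNReal.ofReal (Real.exp (-r)) *
        ENNReal.ofReal (Real.exp (r + Real.log L)) * EReal.exp (-a) := by rw [hcancel, one_mul]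
    _ = _ := by
      rw [exp_neg_coe_add]
      ring

theorem exp_neg_energy_eq_prod_mul {N : ℕ} {g : X → X → EReal} {V : X → EReal} {γ L β : ℝ}
    (hL : 0 < L) (hV : ∀ x, V x ≠ ⊥) (hg : ∀ x z, g x z ≠ ⊥) (U : X → ℝ) (x : Fin N → X)
    (hx : ∀ i j, i < j → g (x i) (x j) ≠ ⊤) :
    EReal.exp (-energy β g V x) =
      (∏ i, ENNReal.ofReal L⁻¹ * EReal.exp (-(((γ * U (x i) : ℝ) : EReal) + V (x i)))) *
        ENNReal.ofReal (Real.exp (logDensity g U γ L β x)) := by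
  have hweight : ∏ i, EReal.exp (-V (x i)) =
      (∏ i, ENNReal.ofReal L⁻¹ * EReal.exp (-(((γ * U (x i) : ℝ) : EReal) + V (x i)))) *
        ENNReal.ofReal (Real.exp (∑ i, (γ * U (x i) + Real.log L))) := by
    rw [Real.exp_sum, ENNReal.ofReal_prod_of_nonneg fun i _ => (Real.exp_pos _).le,
      ← Finset.prod_mul_distrib]
    exact Finset.prod_congr rfl fun i _ => exp_neg_eq_mul_exp_log hL _ _
  rw [exp_neg_energy_eq hV hg x hx, hweight, logDensity, Real.exp_add,
    ENNReal.ofReal_mul (Real.exp_pos _).le]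
  ring

variable [TopologicalSpace X] [MeasurableSpace X] [BorelSpace X] [SecondCountableTopology X]
  {ω : Measure X} {g : X → X → EReal} {V : X → EReal} {θ : X → ℝ} {ρ : Measure X}
  [IsProbabilityMeasure ρ] {D : ℝ≥0} {N : ℕ}

namespace IsAdmissible

theorem lintegral_weightedKernel_prod_ne_top (h : IsAdmissible ω g V θ) (hρ : ρ ≤ D • ω)
    (hθ : Integrable θ ρ) : ∫⁻ q, weightedKernel g θ q.1 q.2 ∂(ρ.prod ρ) ≠ ∞ := by
  rw [lintegral_prod _ h.measurable_weightedKernel.aemeasurable]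
  exact h.lintegral_kernelPotential_ne_top hρ hθ hθ

theorem ae_prod_kernel_ne_top (h : IsAdmissible ω g V θ) (hρ : ρ ≤ D • ω) (hθ : Integrable θ ρ) :
    ∀ᵐ q ∂(ρ.prod ρ), g q.1 q.2 ≠ ⊤ := by
  filter_upwards [ae_lt_top h.measurable_weightedKernel
    (h.lintegral_weightedKernel_prod_ne_top hρ hθ)] with q hq hg
  exact hq.ne ((h.weightedKernel_eq_top_iff _ _).2 hg)

theorem integrable_kernel_prod (h : IsAdmissible ω g V θ) (hρ : ρ ≤ D • ω)
    (hθ : Integrable θ ρ) : Integrable (fun q : X × X => (g q.1 q.2).toReal) (ρ.prod ρ) := by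
  have heq : (fun q : X × X => (g q.1 q.2).toReal) =ᵐ[ρ.prod ρ]
      fun q => (weightedKernel g θ q.1 q.2).toReal - (θ q.1 + θ q.2) := by
    filter_upwards [h.ae_prod_kernel_ne_top hρ hθ] with q hq
    exact h.toReal_kernel hq
  exact (integrable_congr heq).2 <|
    (integrable_toReal_of_lintegral_ne_top h.measurable_weightedKernel.aemeasurable
      (h.lintegral_weightedKernel_prod_ne_top hρ hθ)).sub ((hθ.comp_fst ρ).add (hθ.comp_snd ρ))

theorem ae_pi_kernel_ne_top (h : IsAdmissible ω g V θ) (hρ : ρ ≤ D • ω) (hθ : Integrable θ ρ) :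
    ∀ᵐ x ∂(Measure.pi fun _ : Fin N => ρ), ∀ i j, i < j → g (x i) (x j) ≠ ⊤ := by
  refine ae_all_iff.2 fun i => ae_all_iff.2 fun j => ae_all_iff.2 fun hij => ?_
  have hprod := h.ae_prod_kernel_ne_top hρ hθ
  rw [← map_eval_pair_pi (fun _ => ρ) hij.ne] at hprod
  exact ae_of_ae_map (f := fun x : Fin N → X => (x i, x j)) (by fun_prop) hprod

theorem integrable_kernel_pi (h : IsAdmissible ω g V θ) (hρ : ρ ≤ D • ω) (hθ : Integrable θ ρ)
    {i j : Fin N} (hij : i ≠ j) :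
    Integrable (fun x : Fin N → X => (g (x i) (x j)).toReal) (Measure.pi fun _ => ρ) := by
  have hprod := h.integrable_kernel_prod hρ hθ
  rw [← map_eval_pair_pi (fun _ => ρ) hij] at hprod
  exact hprod.comp_measurable (by fun_prop)

theorem integral_kernel_pi (h : IsAdmissible ω g V θ) (hρ : ρ ≤ D • ω) (hθ : Integrable θ ρ)
    {i j : Fin N} (hij : i ≠ j) :
    ∫ x : Fin N → X, (g (x i) (x j)).toReal ∂(Measure.pi fun _ => ρ) =
      ∫ x, potential g ρ x ∂ρ := by
  have hprod := h.integrable_kernel_prod hρ hθ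
  have hmap : Integrable (fun q : X × X => (g q.1 q.2).toReal)
      ((Measure.pi fun _ => ρ).map fun x => (x i, x j)) := by
    rwa [map_eval_pair_pi (fun _ => ρ) hij]
  rw [← integral_map (φ := fun x : Fin N → X => (x i, x j)) (by fun_prop) hmap.1,
    map_eval_pair_pi (fun _ => ρ) hij, integral_prod _ hprod]
  rfl

theorem integrable_potential_pi (h : IsAdmissible ω g V θ) (hρ : ρ ≤ D • ω)
    (hθ : Integrable θ ρ) (γ L : ℝ) (i : Fin N) :
    Integrable (fun x : Fin N → X => γ * potential g ρ (x i) + Real.log L)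
      (Measure.pi fun _ => ρ) :=
  ((integrable_comp_eval (h.integrable_potential hρ hθ)).const_mul γ).add (integrable_const _)

theorem integrable_sum_kernel_pi (h : IsAdmissible ω g V θ) (hρ : ρ ≤ D • ω)
    (hθ : Integrable θ ρ) (i : Fin N) :
    Integrable (fun x : Fin N → X => ∑ j ∈ Finset.Ioi i, (g (x i) (x j)).toReal)
      (Measure.pi fun _ => ρ) :=
  integrable_finsetSum _ fun _ hj => h.integrable_kernel_pi hρ hθ (Finset.mem_Ioi.1 hj).ne

theorem integrable_logDensity (h : IsAdmissible ω g V θ) (hρ : ρ ≤ D • ω) (hθ : Integrable θ ρ)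
    (γ L β : ℝ) :
    Integrable (logDensity (N := N) g (potential g ρ) γ L β) (Measure.pi fun _ => ρ) :=
  ((integrable_finsetSum _ fun i _ => h.integrable_sum_kernel_pi hρ hθ i).const_mul β).neg.add
    (integrable_finsetSum _ fun i _ => h.integrable_potential_pi hρ hθ γ L i)

theorem integral_logDensity (h : IsAdmissible ω g V θ) (hρ : ρ ≤ D • ω) (hθ : Integrable θ ρ)
    (γ L β : ℝ) :
    ∫ x, logDensity (N := N) g (potential g ρ) γ L β x ∂(Measure.pi fun _ => ρ) =
      N * Real.log L + γ * N * ∫ x, potential g ρ x ∂ρ -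
        β * (N * (N - 1) / 2 * ∫ x, potential g ρ x ∂ρ) := by
  have hkernel (i : Fin N) :
      ∫ x : Fin N → X, ∑ j ∈ Finset.Ioi i, (g (x i) (x j)).toReal ∂(Measure.pi fun _ => ρ) =
        ∑ _j ∈ Finset.Ioi i, ∫ x, potential g ρ x ∂ρ := by
    rw [integral_finsetSum _ fun _ hj => h.integrable_kernel_pi hρ hθ (Finset.mem_Ioi.1 hj).ne]
    exact Finset.sum_congr rfl fun j hj => h.integral_kernel_pi hρ hθ (Finset.mem_Ioi.1 hj).ne
  have hpotential (i : Fin N) :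
      ∫ x : Fin N → X, (γ * potential g ρ (x i) + Real.log L) ∂(Measure.pi fun _ => ρ) =
        γ * ∫ x, potential g ρ x ∂ρ + Real.log L := by
    have hint := h.integrable_potential hρ hθ
    rw [integral_add ((integrable_comp_eval hint).const_mul γ) (integrable_const _),
      integral_const_mul, integral_comp_eval (μ := fun _ : Fin N => ρ) hint.1, integral_const,
      probReal_univ, one_smul]
  have hpairs : Integrable (fun x : Fin N → X =>
      -(β * ∑ i, ∑ j ∈ Finset.Ioi i, (g (x i) (x j)).toReal)) (Measure.pi fun _ => ρ) :=
    ((integrable_finsetSum _ fun i _ => h.integrable_sum_kernel_pi hρ hθ i).const_mul β).neg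
  simp only [logDensity]
  rw [integral_add hpairs
      (integrable_finsetSum _ fun i _ => h.integrable_potential_pi hρ hθ γ L i),
    integral_neg, integral_const_mul,
    integral_finsetSum _ fun i _ => h.integrable_sum_kernel_pi hρ hθ i,
    integral_finsetSum _ fun i _ => h.integrable_potential_pi hρ hθ γ L i]
  simp only [hkernel, hpotential]
  rw [sum_sum_Ioi_const, Finset.sum_const, Finset.card_univ, Fintype.card_fin, nsmul_eq_mul]
  ring

variable [SigmaFinite ω] {γ L : ℝ}

theorem lintegral_exp_logDensity_le_partitionFunction (h : IsAdmissible ω g V θ)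
    (hρ : ρ ≤ D • ω) (hθ : Integrable θ ρ) (hL : 0 < L)
    (hdens : ρ = ω.withDensity fun x => ENNReal.ofReal L⁻¹ *
        EReal.exp (-(((γ * potential g ρ x : ℝ) : EReal) + V x))) (β : ℝ) :
    ∫⁻ x, ENNReal.ofReal (Real.exp (logDensity g (potential g ρ) γ L β x))
      ∂(Measure.pi fun _ : Fin N => ρ) ≤ partitionFunction N ω β g V := by
  set φ : X → ℝ≥0∞ := fun x => ENNReal.ofReal L⁻¹ *
    EReal.exp (-(((γ * potential g ρ x : ℝ) : EReal) + V x))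
  have hφm : Measurable φ := (((h.continuous_potential hρ hθ).measurable.const_mul
    γ).coe_real_ereal.add h.measurable_potential).neg.ereal_exp.const_mul _
  have hprodm : Measurable fun x : Fin N → X => ∏ i, φ (x i) :=
    Finset.measurable_fun_prod _ fun i _ => hφm.comp (measurable_pi_apply i)
  have : SigmaFinite (ω.withDensity φ) := hdens ▸ inferInstance
  have hpi : (Measure.pi fun _ : Fin N => ρ) =
      (Measure.pi fun _ : Fin N => ω).withDensity fun x => ∏ i, φ (x i) := by
    rw [← pi_withDensity (fun _ => ω) fun _ => hφm, ← hdens]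
  have hfinite : ∀ᵐ x ∂(Measure.pi fun _ : Fin N => ω),
      ∏ i, φ (x i) ≠ 0 → ∀ i j, i < j → g (x i) (x j) ≠ ⊤ := by
    rw [← ae_withDensity_iff hprodm, ← hpi]
    exact h.ae_pi_kernel_ne_top hρ hθ
  conv_lhs => rw [hpi]
  refine (lintegral_withDensity_le_lintegral_mul _ hprodm _).trans (lintegral_mono_ae ?_)
  filter_upwards [hfinite] with x hx
  rw [Pi.mul_apply]
  by_cases hzero : ∏ i, φ (x i) = 0
  · rw [hzero, zero_mul]
    exact zero_le
  · exact (exp_neg_energy_eq_prod_mul hL h.potential_ne_bot h.kernel_ne_bot _ x (hx hzero)).ge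

theorem le_partitionFunction (h : IsAdmissible ω g V θ) (hρ : ρ ≤ D • ω) (hθ : Integrable θ ρ)
    (hL : 0 < L)
    (hdens : ρ = ω.withDensity fun x => ENNReal.ofReal L⁻¹ *
        EReal.exp (-(((γ * potential g ρ x : ℝ) : EReal) + V x))) (N : ℕ) (β : ℝ) :
    ENNReal.ofReal (Real.exp (N * Real.log L + γ * N * ∫ x, potential g ρ x ∂ρ -
      β * (N * (N - 1) / 2 * ∫ x, potential g ρ x ∂ρ))) ≤ partitionFunction N ω β g V := by
  rw [← h.integral_logDensity hρ hθ]
  exact (ofReal_exp_integral_le_lintegral (h.integrable_logDensity hρ hθ γ L β)).trans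
    (h.lintegral_exp_logDensity_le_partitionFunction hρ hθ hL hdens β)

end IsAdmissible

end LowerBound

section Chernoff

theorem tendsto_ofReal_exp_succ_mul {r : ℕ → ℝ} {r₀ : ℝ} (hr : Tendsto r atTop (𝓝 r₀))
    (hr₀ : r₀ < 0) :
    Tendsto (fun N : ℕ => ENNReal.ofReal (Real.exp (((N + 1 : ℕ) : ℝ) * r N))) atTop (𝓝 0) := by
  have hsucc : Tendsto (fun N : ℕ => ((N + 1 : ℕ) : ℝ)) atTop atTop :=
    tendsto_natCast_atTop_atTop.comp (tendsto_add_atTop_nat 1)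
  simpa using ENNReal.tendsto_ofReal
    (Real.tendsto_exp_atBot.comp (hsucc.atTop_mul_neg hr₀ hr))

variable {X : Type*} [MeasurableSpace X] {ω : Measure X} [SigmaFinite ω]
  {g : X → X → EReal} {V : X → EReal}

theorem setLIntegral_exp_neg_energy_le {N : ℕ} {β a T : ℝ} {F : X → ℝ≥0∞} (hF : Measurable F)
    (hT : ∫⁻ x, F x ∂ω ≤ ENNReal.ofReal (Real.exp T)) {A : Set (Fin N → X)}
    (hA : ∀ x ∈ A, EReal.exp (-energy β g V x) ≤ ENNReal.ofReal (Real.exp a) * ∏ i, F (x i)) :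
    ∫⁻ x in A, EReal.exp (-energy β g V x) ∂(Measure.pi fun _ => ω) ≤
      ENNReal.ofReal (Real.exp (a + N * T)) := by
  have hprod : Measurable fun x : Fin N → X => ∏ i, F (x i) :=
    Finset.measurable_fun_prod _ fun i _ => hF.comp (measurable_pi_apply i)
  calc ∫⁻ x in A, EReal.exp (-energy β g V x) ∂(Measure.pi fun _ => ω)
      ≤ ∫⁻ x in A, ENNReal.ofReal (Real.exp a) * ∏ i, F (x i) ∂(Measure.pi fun _ => ω) :=
        setLIntegral_mono (hprod.const_mul _) hA
    _ ≤ ∫⁻ x, ENNReal.ofReal (Real.exp a) * ∏ i, F (x i) ∂(Measure.pi fun _ => ω) :=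
        setLIntegral_le_lintegral _ _
    _ = ENNReal.ofReal (Real.exp a) * (∫⁻ x, F x ∂ω) ^ N := by
        rw [lintegral_const_mul _ hprod, lintegral_fin_prod_eq_prod _ fun _ => hF,
          Finset.prod_const, Finset.card_univ, Fintype.card_fin]
    _ ≤ ENNReal.ofReal (Real.exp a) * ENNReal.ofReal (Real.exp T) ^ N := by gcongr
    _ = ENNReal.ofReal (Real.exp (a + N * T)) := by
        rw [← ENNReal.ofReal_pow (Real.exp_pos _).le, ← Real.exp_nat_mul,
          ← ENNReal.ofReal_mul (Real.exp_pos _).le, ← Real.exp_add]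

theorem gibbsMeasure_le_of_exp_neg_energy_le {N : ℕ} {β a l T : ℝ} {F : X → ℝ≥0∞}
    (hF : Measurable F) (hl : ENNReal.ofReal (Real.exp l) ≤ partitionFunction N ω β g V)
    (hT : ∫⁻ x, F x ∂ω ≤ ENNReal.ofReal (Real.exp T)) {A : Set (Fin N → X)}
    (hA : ∀ x ∈ A, EReal.exp (-energy β g V x) ≤ ENNReal.ofReal (Real.exp a) * ∏ i, F (x i)) :
    gibbsMeasure N ω β g V A ≤ ENNReal.ofReal (Real.exp (a + N * T - l)) := by
  have hinv : (partitionFunction N ω β g V)⁻¹ ≤ ENNReal.ofReal (Real.exp (-l)) := by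
    rw [Real.exp_neg, ENNReal.ofReal_inv_of_pos (Real.exp_pos _)]
    exact ENNReal.inv_le_inv.2 hl
  rw [gibbsMeasure, Measure.smul_apply, withDensity_apply', smul_eq_mul, sub_eq_neg_add,
    Real.exp_add, ENNReal.ofReal_mul (Real.exp_pos _).le]
  exact mul_le_mul' hinv (setLIntegral_exp_neg_energy_le hF hT hA)

theorem tendsto_gibbsMeasure_zero {β : ℕ → ℝ} {l : ℝ}
    (hZ : ∀ᶠ N in atTop, ENNReal.ofReal (Real.exp (((N + 1 : ℕ) : ℝ) * l)) ≤
      partitionFunction (N + 1) ω (β N) g V)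
    {F : X → ℝ≥0∞} (hF : Measurable F) {T : ℝ} (hT : ∫⁻ x, F x ∂ω ≤ ENNReal.ofReal (Real.exp T))
    {a : ℕ → ℝ} {a₀ : ℝ} (ha : Tendsto a atTop (𝓝 a₀)) (hlt : a₀ + T < l)
    {A : ∀ N : ℕ, Set (Fin (N + 1) → X)}
    (hA : ∀ᶠ N in atTop, ∀ x ∈ A N, EReal.exp (-energy (β N) g V x) ≤
      ENNReal.ofReal (Real.exp (((N + 1 : ℕ) : ℝ) * a N)) * ∏ i, F (x i)) :
    Tendsto (fun N : ℕ => gibbsMeasure (N + 1) ω (β N) g V (A N)) atTop (𝓝 0) := by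
  refine tendsto_of_tendsto_of_tendsto_of_le_of_le' tendsto_const_nhds
    (tendsto_ofReal_exp_succ_mul ((ha.add_const T).sub_const l) (sub_neg.2 hlt))
    (Eventually.of_forall fun _ => zero_le) ?_
  filter_upwards [hZ, hA] with N hZN hAN
  refine (gibbsMeasure_le_of_exp_neg_energy_le hF hZN hT hAN).trans_eq ?_
  rw [mul_sub, mul_add]

end Chernoff

section EmpiricalMeasure

variable {X : Type*} [MeasurableSpace X] [MeasurableSingletonClass X] {N : ℕ} [NeZero N]

theorem integral_empiricalMeasure (x : Fin N → X) (f : X → ℝ) :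
    ∫ y, f y ∂(empiricalMeasure x : Measure X) = (N : ℝ)⁻¹ * ∑ i, f (x i) := by
  change ∫ y, f y ∂((N : ℝ≥0∞)⁻¹ • ∑ j, Measure.dirac (x j)) = _
  rw [integral_smul_measure, integral_finsetSum_measure fun i _ => integrable_dirac (by simp)]
  simp

theorem integral_prod_empiricalMeasure (x : Fin N → X) {K : X × X → ℝ}
    (hK : Integrable K ((empiricalMeasure x).prod (empiricalMeasure x) : Measure (X × X))) :
    ∫ q, K q ∂((empiricalMeasure x).prod (empiricalMeasure x) : Measure (X × X)) =
      (N : ℝ)⁻¹ * ((N : ℝ)⁻¹ * ∑ i, ∑ j, K (x i, x j)) := by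
  rw [ProbabilityMeasure.toMeasure_prod] at hK ⊢
  rw [integral_prod _ hK, integral_empiricalMeasure]
  simp_rw [fun u => integral_empiricalMeasure x fun z => K (u, z)]
  rw [← Finset.mul_sum]

end EmpiricalMeasure

section Avoidance

variable {X : Type*} [MeasurableSpace X] {ω : Measure X} {g : X → X → EReal} {V : X → EReal}
  {β : ℕ → ℝ} {S S' : Set (ProbabilityMeasure X)}

/-- The empirical measure of the gas avoids the set `S` with probability tending to one. The
inverse temperature of the gas of `N + 1` particles is `β N`. -/
def IsAvoided (ω : Measure X) (g : X → X → EReal) (V : X → EReal) (β : ℕ → ℝ)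
    (S : Set (ProbabilityMeasure X)) : Prop :=
  Tendsto (fun N : ℕ => gibbsMeasure (N + 1) ω (β N) g V {x | empiricalMeasure x ∈ S})
    atTop (𝓝 0)

namespace IsAvoided

theorem empty : IsAvoided ω g V β ∅ := by
  simp [IsAvoided]

theorem mono (hS : IsAvoided ω g V β S) (hle : S' ⊆ S) : IsAvoided ω g V β S' :=
  tendsto_of_tendsto_of_tendsto_of_le_of_le tendsto_const_nhds hS (fun _ => zero_le)
    fun _ => measure_mono fun _ hx => hle hx

theorem union (hS : IsAvoided ω g V β S) (hS' : IsAvoided ω g V β S') :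
    IsAvoided ω g V β (S ∪ S') := by
  have hadd := hS.add hS'
  rw [add_zero] at hadd
  exact tendsto_of_tendsto_of_tendsto_of_le_of_le tendsto_const_nhds hadd (fun _ => zero_le)
    fun _ => measure_union_le _ _

end IsAvoided

end Avoidance

section InverseTemperature

variable {β : ℕ → ℝ} {γ : ℝ}

theorem tendsto_zero_of_tendsto_mul_succ
    (hβ : Tendsto (fun N : ℕ => β N * ((N + 1 : ℕ) : ℝ)) atTop (𝓝 γ)) :
    Tendsto β atTop (𝓝 0) := by
  have hinv : Tendsto (fun N : ℕ => ((N + 1 : ℕ) : ℝ)⁻¹) atTop (𝓝 0) :=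
    tendsto_inv_atTop_zero.comp (tendsto_natCast_atTop_atTop.comp (tendsto_add_atTop_nat 1))
  have hmul := hβ.mul hinv
  rw [mul_zero] at hmul
  exact hmul.congr fun N => mul_inv_cancel_right₀ (Nat.cast_ne_zero.2 N.succ_ne_zero) _

theorem tendsto_mul_of_tendsto_mul_succ
    (hβ : Tendsto (fun N : ℕ => β N * ((N + 1 : ℕ) : ℝ)) atTop (𝓝 γ)) :
    Tendsto (fun N : ℕ => β N * N) atTop (𝓝 γ) := by
  have hsub := hβ.sub (tendsto_zero_of_tendsto_mul_succ hβ)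
  rw [sub_zero] at hsub
  refine hsub.congr fun N => ?_
  rw [Nat.cast_succ, mul_add, mul_one, add_sub_cancel_right]

end InverseTemperature

section WeightBounds

variable {X : Type*} [TopologicalSpace X] [MeasurableSpace X] {ω : Measure X}
  {g : X → X → EReal} {V : X → EReal} {θ : X → ℝ} {N : ℕ} {β κ : ℝ}

namespace IsAdmissible

theorem exp_neg_energy_le_prod (h : IsAdmissible ω g V θ) (hβ : 0 ≤ β) (hκ : β * (N - 1) ≤ κ)
    (x : Fin N → X) :
    EReal.exp (-energy β g V x) ≤
      ∏ i, (EReal.exp (-V (x i)) * ENNReal.ofReal (Real.exp (κ * θ (x i)))) := by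
  rw [Finset.prod_mul_distrib, ← ENNReal.ofReal_prod_of_nonneg fun i _ => (Real.exp_pos _).le,
    ← Real.exp_sum, ← Finset.mul_sum, mul_comm]
  refine (h.exp_neg_energy_le_of_le hβ (K := fun _ => 0) (b := 0) (fun _ => le_rfl)
    (fun _ => le_rfl) (fun _ => by simp) x).trans
    (mul_le_mul_left (ENNReal.ofReal_le_ofReal (Real.exp_le_exp.2 ?_)) _)
  simpa using mul_le_mul_of_nonneg_right hκ
    (Finset.sum_nonneg fun i (_ : i ∈ Finset.univ) => h.theta_nonneg (x i))

theorem exp_neg_energy_le_of_le_prod (h : IsAdmissible ω g V θ) {N : ℕ} {β κ r : ℝ} (hβ : 0 ≤ β)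
    (hκ : β * (N - 1) ≤ κ) {f : X → ℝ≥0∞} {x : Fin N → X}
    (hr : ENNReal.ofReal (Real.exp (N * r)) ≤ ∏ i, f (x i)) :
    EReal.exp (-energy β g V x) ≤ ENNReal.ofReal (Real.exp (N * -r)) *
      ∏ i, (EReal.exp (-V (x i)) * ENNReal.ofReal (Real.exp (κ * θ (x i))) * f (x i)) := by
  have hone : 1 ≤ ENNReal.ofReal (Real.exp (N * -r)) * ∏ i, f (x i) := by
    refine Eq.trans_le ?_ (mul_le_mul_right hr _)
    rw [← ENNReal.ofReal_mul (Real.exp_pos _).le, ← Real.exp_add, mul_neg, neg_add_cancel,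
      Real.exp_zero, ENNReal.ofReal_one]
  rw [Finset.prod_mul_distrib, mul_left_comm]
  exact (h.exp_neg_energy_le_prod hβ hκ x).trans (le_mul_of_one_le_right' hone)

variable [BorelSpace X]

theorem partitionFunction_ne_top (h : IsAdmissible ω g V θ) [SigmaFinite ω] (N : ℕ)
    (hβ : 0 ≤ β) : partitionFunction N ω β g V ≠ ∞ := by
  have hκ : β * (N - 1) ≤ β * N := mul_le_mul_of_nonneg_left (by simp) hβ
  refine ((lintegral_mono fun x => h.exp_neg_energy_le_prod hβ hκ x).trans_lt ?_).ne
  rw [lintegral_fin_prod_eq_prod (fun _ => ω) fun _ => h.measurable_weight _]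
  exact ENNReal.prod_lt_top fun _ _ => h.lintegral_weight_lt_top (by positivity)

theorem isProbabilityMeasure_gibbsMeasure (h : IsAdmissible ω g V θ) [SigmaFinite ω]
    (hβ : 0 ≤ β) (hZ : partitionFunction N ω β g V ≠ 0) :
    IsProbabilityMeasure (gibbsMeasure N ω β g V) := by
  constructor
  rw [gibbsMeasure, Measure.smul_apply, withDensity_apply _ MeasurableSet.univ,
    Measure.restrict_univ, smul_eq_mul]
  exact ENNReal.inv_mul_cancel hZ (h.partitionFunction_ne_top N hβ)

end IsAdmissible

end WeightBounds

section ExponentialMoments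

theorem exists_integral_exp_add_mul_le {X : Type*} [MeasurableSpace X] {ν : Measure X}
    {f θ : X → ℝ} {B : ℝ} (hf : Measurable f) (hfB : ∀ x, f x ≤ B)
    (hθ : Measurable θ) (hθ₀ : ∀ x, 0 ≤ θ x) (hexp : Integrable (fun x => Real.exp (θ x)) ν)
    {ε : ℝ} (hε : 0 < ε) :
    ∃ δ : ℝ, 0 < δ ∧ Integrable (fun x => Real.exp (f x + δ * θ x)) ν ∧
      ∫ x, Real.exp (f x + δ * θ x) ∂ν ≤ ∫ x, Real.exp (f x) ∂ν + ε := by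
  have hmeas (δ : ℝ) : AEStronglyMeasurable (fun x => Real.exp (f x + δ * θ x)) ν :=
    (hf.add (hθ.const_mul δ)).exp.aestronglyMeasurable
  have hbound : ∀ᶠ δ : ℝ in 𝓝[>] 0, ∀ᵐ x ∂ν,
      ‖Real.exp (f x + δ * θ x)‖ ≤ Real.exp B * Real.exp (θ x) := by
    filter_upwards [eventually_nhdsWithin_of_eventually_nhds (eventually_le_nhds one_pos)]
      with δ hδ
    refine ae_of_all _ fun x => ?_
    rw [Real.norm_of_nonneg (Real.exp_pos _).le, ← Real.exp_add]
    exact Real.exp_le_exp.2 (add_le_add (hfB x) (mul_le_of_le_one_left (hθ₀ x) hδ))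
  have hlim : Tendsto (fun δ => ∫ x, Real.exp (f x + δ * θ x) ∂ν) (𝓝[>] 0)
      (𝓝 (∫ x, Real.exp (f x) ∂ν)) := by
    refine tendsto_integral_filter_of_dominated_convergence _ (Eventually.of_forall hmeas) hbound
      (hexp.const_mul _) (ae_of_all _ fun x => tendsto_nhdsWithin_of_tendsto_nhds ?_)
    have hcont : Continuous fun δ : ℝ => Real.exp (f x + δ * θ x) := by fun_prop
    simpa using hcont.tendsto 0
  obtain ⟨δ, hδ, hδbound, hδpos⟩ := ((hlim.eventually_le_const (lt_add_of_pos_right _ hε)).and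
    (hbound.and self_mem_nhdsWithin)).exists
  exact ⟨δ, hδpos, (hexp.const_mul _).mono' (hmeas δ) hδbound, hδ⟩

end ExponentialMoments

section TiltedWeight

variable {X : Type*} [TopologicalSpace X] [MeasurableSpace X] [BorelSpace X] {ω : Measure X}
  {g : X → X → EReal} {V : X → EReal} {θ : X → ℝ} {γ : ℝ}

namespace IsAdmissible

theorem integrable_exp_theta_referenceMeasure (h : IsAdmissible ω g V θ) (hγ : 0 ≤ γ) :
    Integrable (fun x => Real.exp (θ x)) (referenceMeasure ω V θ γ) :=
  (lintegral_ofReal_ne_top_iff_integrable h.measurable_theta.exp.aestronglyMeasurable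
    (ae_of_all _ fun x => (Real.exp_pos _).le)).1
    (by simpa using (h.lintegral_exp_theta_referenceMeasure_lt_top hγ zero_le_one).ne)

theorem lintegral_tiltedWeight (h : IsAdmissible ω g V θ) (hγ : 0 ≤ γ) {f : X → ℝ}
    (hf : Measurable f) (δ : ℝ) :
    ∫⁻ x, EReal.exp (-V x) * ENNReal.ofReal (Real.exp ((γ + δ) * θ x + f x)) ∂ω =
      (∫⁻ x, EReal.exp (-shiftedPotential V θ γ x) ∂ω) *
        ∫⁻ x, ENNReal.ofReal (Real.exp (f x + δ * θ x)) ∂(referenceMeasure ω V θ γ) := by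
  have htilt : Measurable fun x => ENNReal.ofReal (Real.exp (f x + δ * θ x)) :=
    (hf.add (h.measurable_theta.const_mul δ)).exp.ennreal_ofReal
  rw [h.lintegral_referenceMeasure htilt, ← mul_assoc,
    ENNReal.mul_inv_cancel (h.normalization_ne_zero hγ) (h.lintegral_lt_top γ hγ).ne, one_mul]
  refine lintegral_congr fun x => ?_
  rw [mul_assoc, ← ENNReal.ofReal_mul (Real.exp_pos _).le, ← Real.exp_add]
  congr 3
  ring

theorem exists_lintegral_tiltedWeight_le (h : IsAdmissible ω g V θ) (hγ : 0 ≤ γ) (f : X →ᵇ ℝ)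
    {ε : ℝ} (hε : 0 < ε) :
    ∃ δ : ℝ, 0 < δ ∧
      ∫⁻ x, EReal.exp (-V x) * ENNReal.ofReal (Real.exp ((γ + δ) * θ x + f x)) ∂ω ≤
        ENNReal.ofReal (Real.exp
          (Real.log (∫⁻ x, EReal.exp (-shiftedPotential V θ γ x) ∂ω).toReal +
            (∫ x, (Real.exp (f x) - 1) ∂(referenceMeasure ω V θ γ) + ε))) := by
  have := h.isProbabilityMeasure_referenceMeasure hγ
  have hfm : Measurable f := f.continuous.measurable
  have hfint : Integrable (fun x => Real.exp (f x)) (referenceMeasure ω V θ γ) :=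
    Integrable.of_bound hfm.exp.aestronglyMeasurable (Real.exp ‖f‖) (ae_of_all _ fun x => by
      rw [Real.norm_of_nonneg (Real.exp_pos _).le]
      exact Real.exp_le_exp.2 (f.apply_le_norm x))
  obtain ⟨δ, hδ, hint, hle⟩ := exists_integral_exp_add_mul_le hfm f.apply_le_norm
    h.measurable_theta h.theta_nonneg (h.integrable_exp_theta_referenceMeasure hγ) hε
  have htilt := h.lintegral_tiltedWeight hγ hfm δ
  set C := ∫⁻ x, EReal.exp (-shiftedPotential V θ γ x) ∂ω
  have hCtop : C ≠ ∞ := (h.lintegral_lt_top γ hγ).ne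
  have hCpos : 0 < C.toReal := ENNReal.toReal_pos (h.normalization_ne_zero hγ) hCtop
  refine ⟨δ, hδ, ?_⟩
  rw [htilt, Real.exp_add (Real.log C.toReal), Real.exp_log hCpos, ENNReal.ofReal_mul hCpos.le,
    ENNReal.ofReal_toReal hCtop, ← ofReal_integral_eq_lintegral_ofReal hint
    (ae_of_all _ fun x => (Real.exp_pos _).le), integral_sub hfint (integrable_const _),
    integral_const, probReal_univ, one_smul]
  gcongr
  linarith [Real.add_one_le_exp
    (∫ x, Real.exp (f x) ∂(referenceMeasure ω V θ γ) - 1 + ε)]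

end IsAdmissible

end TiltedWeight

section TestFunctions

variable {X : Type*} [MetricSpace X] [MeasurableSpace X] [BorelSpace X]

theorem lintegral_le_liminf_boundedLipschitzMinorant {G : X → ℝ≥0∞} (hG : LowerSemicontinuous G)
    (m : Measure X) [IsFiniteMeasure m] :
    ∫⁻ q, G q ∂m ≤
      liminf (fun n => ENNReal.ofReal (∫ q, boundedLipschitzMinorant G n q ∂m)) atTop := by
  refine (lintegral_mono (le_liminf_lipschitzMinorant hG)).trans
    ((lintegral_liminf_le' fun n =>
      (boundedLipschitzMinorant G n).continuous.measurable.ennreal_ofReal.aemeasurable).trans_eq ?_)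
  congr 1 with n
  exact (ofReal_integral_eq_lintegral_ofReal ((boundedLipschitzMinorant G n).integrable _)
    (ae_of_all _ (lipschitzMinorant_nonneg G n))).symm

variable [SecondCountableTopology X] {ω : Measure X} {g : X → X → EReal} {V : X → EReal}
  {θ : X → ℝ}

namespace IsAdmissible

theorem weightedEnergy_le_liminf (h : IsAdmissible ω g V θ) (ρ : ProbabilityMeasure X) :
    weightedEnergy g θ (ρ : Measure X) ≤ liminf (fun n => ENNReal.ofReal
      (∫ q, boundedLipschitzMinorant (fun q : X × X => weightedKernel g θ q.1 q.2) n q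
        ∂(ρ.prod ρ : Measure (X × X)))) atTop :=
  (lintegral_prod _ h.measurable_weightedKernel.aemeasurable).symm.trans_le
    (lintegral_le_liminf_boundedLipschitzMinorant h.lowerSemicontinuous_weightedKernel _)

theorem exists_lt_add_donskerVaradhan (h : IsAdmissible ω g V θ) {γ : ℝ} (hγ : 0 ≤ γ)
    {ρ : ProbabilityMeasure X} {m : ℝ} (hρ : ENNReal.ofReal m < freeEnergy ω g V θ γ ρ) :
    ∃ (K : X × X →ᵇ ℝ) (f : X →ᵇ ℝ), (∀ q, 0 ≤ K q) ∧
      (∀ q, ENNReal.ofReal (K q) ≤ weightedKernel g θ q.1 q.2) ∧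
      m < γ / 2 * ∫ q, K q ∂(ρ.prod ρ : Measure (X × X)) +
        donskerVaradhan (ρ : Measure X) (referenceMeasure ω V θ γ) f := by
  have := h.isProbabilityMeasure_referenceMeasure hγ
  by_contra! hcon
  refine hρ.not_ge ?_
  set K := boundedLipschitzMinorant fun q : X × X => weightedKernel g θ q.1 q.2
  have hle (n : ℕ) (f : X →ᵇ ℝ) := hcon (K n) f (lipschitzMinorant_nonneg _ n)
    (ofReal_lipschitzMinorant_le _ n)
  have hsum (n : ℕ) : ENNReal.ofReal (γ / 2) *
      ENNReal.ofReal (∫ q, K n q ∂(ρ.prod ρ : Measure (X × X))) +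
      klDiv (ρ : Measure X) (referenceMeasure ω V θ γ) ≤ ENNReal.ofReal m := by
    have hK₀ : 0 ≤ ∫ q, K n q ∂(ρ.prod ρ : Measure (X × X)) :=
      integral_nonneg (lipschitzMinorant_nonneg _ n)
    have hzero : γ / 2 * ∫ q, K n q ∂(ρ.prod ρ : Measure (X × X)) ≤ m := by
      simpa [donskerVaradhan] using hle n 0
    have hkl := klDiv_le_of_forall_boundedContinuous fun f => le_sub_iff_add_le'.2 (hle n f)
    refine (add_le_add_right hkl _).trans_eq ?_
    rw [← ENNReal.ofReal_mul (by positivity), ← ENNReal.ofReal_add (by positivity)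
      (sub_nonneg.2 hzero), add_sub_cancel]
  calc freeEnergy ω g V θ γ ρ
      ≤ ENNReal.ofReal (γ / 2) * liminf (fun n => ENNReal.ofReal
          (∫ q, K n q ∂(ρ.prod ρ : Measure (X × X)))) atTop +
          klDiv (ρ : Measure X) (referenceMeasure ω V θ γ) := by
        rw [freeEnergy]
        gcongr
        exact h.weightedEnergy_le_liminf ρ
    _ = liminf (fun n => ENNReal.ofReal (γ / 2) *
          ENNReal.ofReal (∫ q, K n q ∂(ρ.prod ρ : Measure (X × X))) +
          klDiv (ρ : Measure X) (referenceMeasure ω V θ γ)) atTop := by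
        rw [liminf_add_const, ENNReal.liminf_const_mul_of_ne_top ENNReal.ofReal_ne_top] <;>
          isBoundedDefault
    _ ≤ ENNReal.ofReal m := liminf_le_of_frequently_le' (Frequently.of_forall hsum)

end IsAdmissible

end TestFunctions

section LocalAvoidance

variable {X : Type*} [MetricSpace X] [MeasurableSpace X] [BorelSpace X]
  [SecondCountableTopology X] {ω : Measure X} {g : X → X → EReal} {V : X → EReal} {θ : X → ℝ}

theorem isOpen_setOf_lt_integral_prod_and_lt_integral (K : X × X →ᵇ ℝ) (f : X →ᵇ ℝ) (a b : ℝ) :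
    IsOpen {σ : ProbabilityMeasure X |
      a < ∫ q, K q ∂(σ.prod σ : Measure (X × X)) ∧ b < ∫ x, f x ∂(σ : Measure X)} := by
  have hK : Continuous fun σ : ProbabilityMeasure X =>
      ∫ q, K q ∂(σ.prod σ : Measure (X × X)) :=
    (ProbabilityMeasure.continuous_integral_boundedContinuousFunction K).comp
      ((ProbabilityMeasure.continuous_prod (α := X) (β := X)).comp
        (continuous_id.prodMk continuous_id))
  exact (isOpen_lt continuous_const hK).inter (isOpen_lt continuous_const
    (ProbabilityMeasure.continuous_integral_boundedContinuousFunction f))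

namespace IsAdmissible

theorem exp_neg_energy_le_of_le_integral (h : IsAdmissible ω g V θ) {N : ℕ} [NeZero N]
    {β κ a b : ℝ} (hβ : 0 ≤ β) (hκ : β * (N - 1) ≤ κ) {K : X × X →ᵇ ℝ} (hK0 : ∀ q, 0 ≤ K q)
    (hK : ∀ q, ENNReal.ofReal (K q) ≤ weightedKernel g θ q.1 q.2) {f : X → ℝ} {x : Fin N → X}
    (ha : a ≤ ∫ q, K q ∂((empiricalMeasure x).prod (empiricalMeasure x) : Measure (X × X)))
    (hb : b ≤ ∫ y, f y ∂(empiricalMeasure x : Measure X)) :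
    EReal.exp (-energy β g V x) ≤
      ENNReal.ofReal (Real.exp (N * (-(β * N / 2 * a) + β / 2 * ‖K‖ - b))) *
        ∏ i, (EReal.exp (-V (x i)) * ENNReal.ofReal (Real.exp (κ * θ (x i) + f (x i)))) := by
  have hN : (0 : ℝ) < N := Nat.cast_pos.2 (NeZero.pos N)
  rw [integral_empiricalMeasure, le_inv_mul_iff₀ hN] at hb
  rw [integral_prod_empiricalMeasure x (K.integrable _), le_inv_mul_iff₀ hN,
    le_inv_mul_iff₀ hN] at ha
  refine (h.exp_neg_energy_le_of_le hβ hK0 K.apply_le_norm hK x).trans ?_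
  rw [Finset.prod_mul_distrib, ← ENNReal.ofReal_prod_of_nonneg fun i _ => (Real.exp_pos _).le,
    ← Real.exp_sum, mul_left_comm, ← ENNReal.ofReal_mul (Real.exp_pos _).le, ← Real.exp_add,
    mul_comm, Finset.sum_add_distrib, ← Finset.mul_sum]
  refine mul_le_mul_right (ENNReal.ofReal_le_ofReal (Real.exp_le_exp.2 ?_)) _
  have hpair : β / 2 * (N * (N * a)) ≤ β / 2 * ∑ i, ∑ j, K (x i, x j) :=
    mul_le_mul_of_nonneg_left ha (by positivity)
  have htheta : β * (N - 1) * ∑ i, θ (x i) ≤ κ * ∑ i, θ (x i) :=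
    mul_le_mul_of_nonneg_right hκ (Finset.sum_nonneg fun i _ => h.theta_nonneg _)
  linarith

/-- The test functions `K` and `f` almost realize the free energy of `ρ`. Near `ρ`, the Boltzmann
weight is at most `exp (-N (γ/2 ∬ K dρ dρ + ∫ f dρ))` times a product whose integral is
`(C_γ ∫ exp f dν_γ)^N`, up to errors `exp (N ε)`. -/
theorem exists_nhds_isAvoided (h : IsAdmissible ω g V θ) [SigmaFinite ω] {γ : ℝ} (hγ : 0 ≤ γ)
    {β : ℕ → ℝ} (hβ0 : ∀ N, 0 ≤ β N)
    (hβ : Tendsto (fun N : ℕ => β N * ((N + 1 : ℕ) : ℝ)) atTop (𝓝 γ)) {l : ℝ}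
    (hZ : ∀ᶠ N in atTop, ENNReal.ofReal (Real.exp (((N + 1 : ℕ) : ℝ) * l)) ≤
      partitionFunction (N + 1) ω (β N) g V) {ρ : ProbabilityMeasure X}
    (hρ : ENNReal.ofReal (Real.log (∫⁻ x, EReal.exp (-shiftedPotential V θ γ x) ∂ω).toReal - l) <
      freeEnergy ω g V θ γ ρ) :
    ∃ W ∈ 𝓝 ρ, IsAvoided ω g V β W := by
  obtain ⟨K, f, hK0, hK, hgap⟩ := h.exists_lt_add_donskerVaradhan hγ hρ
  set C := ∫⁻ x, EReal.exp (-shiftedPotential V θ γ x) ∂ω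
  set k := ∫ q, K q ∂(ρ.prod ρ : Measure (X × X))
  rw [donskerVaradhan] at hgap
  set w := ∫ x, f x ∂(ρ : Measure X)
  set E := ∫ x, (Real.exp (f x) - 1) ∂(referenceMeasure ω V θ γ)
  obtain ⟨ε, hε, hεgap⟩ : ∃ ε : ℝ, 0 < ε ∧
      -(γ / 2 * (k - ε)) - (w - ε) + (Real.log C.toReal + (E + ε)) < l := by
    refine ⟨(γ / 2 * k + (w - E) - (Real.log C.toReal - l)) / (γ + 4),
      div_pos (sub_pos.2 hgap) (by positivity), ?_⟩
    have hdiv := div_mul_cancel₀ (γ / 2 * k + (w - E) - (Real.log C.toReal - l))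
      (by positivity : γ + 4 ≠ 0)
    linarith
  obtain ⟨δ, hδ, hT⟩ := h.exists_lintegral_tiltedWeight_le hγ f hε
  refine ⟨_, (isOpen_setOf_lt_integral_prod_and_lt_integral K f (k - ε) (w - ε)).mem_nhds
    ⟨sub_lt_self _ hε, sub_lt_self _ hε⟩, ?_⟩
  have hrate : Tendsto (fun N : ℕ => -(β N * ((N + 1 : ℕ) : ℝ) / 2 * (k - ε)) +
      β N / 2 * ‖K‖ - (w - ε)) atTop (𝓝 (-(γ / 2 * (k - ε)) - (w - ε))) := by
    simpa using ((((hβ.div_const 2).mul_const (k - ε)).neg).add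
      (((tendsto_zero_of_tendsto_mul_succ hβ).div_const 2).mul_const ‖K‖)).sub_const (w - ε)
  have hF : Measurable fun x =>
      EReal.exp (-V x) * ENNReal.ofReal (Real.exp ((γ + δ) * θ x + f x)) :=
    h.measurable_potential.neg.ereal_exp.mul
      ((h.measurable_theta.const_mul _).add f.continuous.measurable).exp.ennreal_ofReal
  refine tendsto_gibbsMeasure_zero hZ hF hT hrate hεgap ?_
  filter_upwards [(tendsto_mul_of_tendsto_mul_succ hβ).eventually_le_const
    (lt_add_of_pos_right γ hδ)] with N hN x hx
  exact h.exp_neg_energy_le_of_le_integral (hβ0 N) (by simpa using hN) hK0 hK hx.1.le hx.2.le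

end IsAdmissible

end LocalAvoidance

section Exhaustion

theorem exists_lintegral_lt_top_of_tsum_measure {X : Type*} [MeasurableSpace X] {τ : Measure X}
    [IsFiniteMeasure τ] {S : ℕ → Set X} (hS : ∀ j, MeasurableSet (S j)) {w : ℕ → ℝ≥0∞}
    (hsum : ∑' j, w j * τ (S j) < ∞) :
    ∃ f : X → ℝ≥0∞, Measurable f ∧ ∫⁻ x, f x ∂τ < ∞ ∧ (∀ x, 1 ≤ f x) ∧
      ∀ j, ∀ x ∈ S j, w j ≤ f x := by
  have hmeas (j : ℕ) : Measurable ((S j).indicator fun _ => w j) :=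
    measurable_const.indicator (hS j)
  refine ⟨fun x => 1 + ∑' j, (S j).indicator (fun _ => w j) x,
    measurable_const.add (Measurable.tsum hmeas), ?_, fun _ => le_self_add, fun j x hx => ?_⟩
  · rw [lintegral_add_left measurable_const, lintegral_tsum fun j => (hmeas j).aemeasurable,
      lintegral_const, one_mul]
    simp only [lintegral_indicator_const (hS _)]
    exact ENNReal.add_lt_top.2 ⟨measure_lt_top _ _, hsum⟩
  · calc w j = (S j).indicator (fun _ => w j) x := by rw [Set.indicator_of_mem hx]
      _ ≤ ∑' j, (S j).indicator (fun _ => w j) x := ENNReal.le_tsum j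
      _ ≤ _ := le_add_self

theorem exists_exhaustion_lintegral_lt_top {X : Type*} [MetricSpace X] [MeasurableSpace X]
    [BorelSpace X] [SecondCountableTopology X] [LocallyCompactSpace X] (τ : Measure X)
    [IsFiniteMeasure τ] {w : ℕ → ℝ≥0∞} (hw₀ : ∀ j, w j ≠ 0) (hw : ∀ j, w j ≠ ∞) :
    ∃ (K : ℕ → Set X) (f : X → ℝ≥0∞), (∀ j, IsCompact (K j)) ∧ Measurable f ∧
      ∫⁻ x, f x ∂τ < ∞ ∧ (∀ x, 1 ≤ f x) ∧ ∀ j, ∀ x ∈ (K j)ᶜ, w j ≤ f x := by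
  obtain ⟨ε, hε, hsum⟩ := ENNReal.exists_pos_sum_of_countable' (ε := 1) one_ne_zero ℕ
  have htight (j : ℕ) : ∃ K : Set X, IsCompact K ∧ τ Kᶜ ≤ ε j / w j := by
    obtain ⟨K, hK, hKτ⟩ := isTightMeasureSet_iff_exists_isCompact_measure_compl_le.1
      (isTightMeasureSet_singleton_of_innerRegular (μ := τ)) (ε j / w j)
      (ENNReal.div_pos (hε j).ne' (hw j))
    exact ⟨K, hK, hKτ τ rfl⟩
  choose K hK hKτ using htight
  have hfin : ∑' j, w j * τ (K j)ᶜ < ∞ :=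
    ((ENNReal.tsum_le_tsum fun j => (mul_le_mul_right (hKτ j) _).trans_eq
      (ENNReal.mul_div_cancel (hw₀ j) (hw j))).trans_lt hsum).trans ENNReal.one_lt_top
  obtain ⟨f, hf⟩ := exists_lintegral_lt_top_of_tsum_measure
    (fun j => (hK j).isClosed.measurableSet.compl) hfin
  exact ⟨K, f, hK, hf⟩

theorem ofReal_exp_le_prod_of_le_empiricalMeasure {X : Type*} [MeasurableSpace X]
    [MeasurableSingletonClass X] {N : ℕ} [NeZero N] (x : Fin N → X) {f : X → ℝ≥0∞}
    (hf : ∀ y, 1 ≤ f y) {S : Set X} (hS : MeasurableSet S) {a r : ℝ}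
    (hfS : ∀ y ∈ S, ENNReal.ofReal (Real.exp a) ≤ f y)
    (hr : r ≤ a * (empiricalMeasure x : Measure X).real S) :
    ENNReal.ofReal (Real.exp (N * r)) ≤ ∏ i, f (x i) := by
  have hN : (0 : ℝ) < N := Nat.cast_pos.2 (NeZero.pos N)
  have hsum : N * r ≤ ∑ i, a * S.indicator 1 (x i) := by
    rw [← integral_indicator_one hS, integral_empiricalMeasure, mul_left_comm,
      le_inv_mul_iff₀ hN] at hr
    rwa [← Finset.mul_sum]
  calc ENNReal.ofReal (Real.exp (N * r))
      ≤ ENNReal.ofReal (Real.exp (∑ i, a * S.indicator 1 (x i))) :=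
        ENNReal.ofReal_le_ofReal (Real.exp_le_exp.2 hsum)
    _ = ∏ i, ENNReal.ofReal (Real.exp (a * S.indicator 1 (x i))) := by
        rw [Real.exp_sum, ENNReal.ofReal_prod_of_nonneg fun i _ => (Real.exp_pos _).le]
    _ ≤ ∏ i, f (x i) := Finset.prod_le_prod' fun i _ => by
        by_cases hi : x i ∈ S
        · simpa [hi] using hfS _ hi
        · simpa [hi] using hf _

end Exhaustion

section ExponentialTightness

variable {X : Type*} [MetricSpace X] [MeasurableSpace X] [BorelSpace X]
  [SecondCountableTopology X] [LocallyCompactSpace X] {ω : Measure X} [SigmaFinite ω]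
  {g : X → X → EReal} {V : X → EReal} {θ : X → ℝ} {γ l : ℝ} {β : ℕ → ℝ}

namespace IsAdmissible

/-- The weight `e^{-V + (γ + 1) ϑ}` integrates a function `f ≥ exp (j + 1)` off a compact set
`K j`. A configuration with a fraction at least `R / (j + 1)` of its points off `K j` satisfies
`∏ f (x i) ≥ exp (N R)`, which is too expensive for large `R`. -/
theorem exists_isCompact_isAvoided_compl (h : IsAdmissible ω g V θ) (hγ : 0 ≤ γ)
    (hβ0 : ∀ N, 0 ≤ β N) (hβ : Tendsto (fun N : ℕ => β N * ((N + 1 : ℕ) : ℝ)) atTop (𝓝 γ))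
    (hZ : ∀ᶠ N in atTop, ENNReal.ofReal (Real.exp (((N + 1 : ℕ) : ℝ) * l)) ≤
      partitionFunction (N + 1) ω (β N) g V) :
    ∃ 𝒦 : Set (ProbabilityMeasure X), IsCompact 𝒦 ∧ IsAvoided ω g V β 𝒦ᶜ := by
  have hfinite : IsFiniteMeasure (ω.withDensity fun x =>
      EReal.exp (-V x) * ENNReal.ofReal (Real.exp ((γ + 1) * θ x))) :=
    isFiniteMeasure_withDensity (h.lintegral_weight_lt_top (by positivity)).ne
  obtain ⟨K, f, hK, hf, hfint, hf1, hfK⟩ := exists_exhaustion_lintegral_lt_top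
    (ω.withDensity fun x => EReal.exp (-V x) * ENNReal.ofReal (Real.exp ((γ + 1) * θ x)))
    (w := fun j => ENNReal.ofReal (Real.exp (j + 1)))
    (fun _ => (ENNReal.ofReal_pos.2 (Real.exp_pos _)).ne') fun _ => ENNReal.ofReal_ne_top
  rw [lintegral_withDensity_eq_lintegral_mul _ (h.measurable_weight _) hf] at hfint
  obtain ⟨T, hT⟩ : ∃ T : ℝ, ∫⁻ x, EReal.exp (-V x) * ENNReal.ofReal (Real.exp ((γ + 1) * θ x)) *
      f x ∂ω ≤ ENNReal.ofReal (Real.exp T) :=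
    ⟨_, (ENNReal.le_ofReal_iff_toReal_le hfint.ne (Real.exp_pos _).le).2
      ((le_add_of_nonneg_right zero_le_one).trans (Real.add_one_le_exp _))⟩
  obtain ⟨R, hR, hRT⟩ : ∃ R : ℝ, 0 < R ∧ -R + T < l :=
    ⟨|T - l| + 1, by positivity, by linarith [le_abs_self (T - l)]⟩
  have hlim : Tendsto (fun j : ℕ => (R * (1 / ((j : ℝ) + 1))).toNNReal) atTop (𝓝 0) := by
    simpa using tendsto_real_toNNReal
      ((tendsto_one_div_add_atTop_nhds_zero_nat (𝕜 := ℝ)).const_mul R)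
  refine ⟨_, isCompact_setOfPred_probabilityMeasure_mass_eq_compl_isCompact_le hlim hK
    (Or.inl inferInstance), tendsto_gibbsMeasure_zero hZ ((h.measurable_weight _).mul hf) hT
    (tendsto_const_nhds (x := -R)) hRT ?_⟩
  filter_upwards [(tendsto_mul_of_tendsto_mul_succ hβ).eventually_le_const (lt_add_one γ)]
    with N hN x hx
  obtain ⟨j, hj⟩ : ∃ j : ℕ, (R * (1 / ((j : ℝ) + 1))).toNNReal < empiricalMeasure x (K j)ᶜ := by
    by_contra! hle
    exact hx hle
  refine h.exp_neg_energy_le_of_le_prod (hβ0 N) (by simpa using hN)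
    (ofReal_exp_le_prod_of_le_empiricalMeasure x hf1 (hK j).isClosed.measurableSet.compl (hfK j) ?_)
  rw [← Real.toNNReal_coe (r := empiricalMeasure x (K j)ᶜ),
    Real.toNNReal_lt_toNNReal_iff_of_nonneg (by positivity), mul_one_div,
    div_lt_iff₀' (by positivity)] at hj
  exact hj.le

end IsAdmissible

end ExponentialTightness

section LawOfLargeNumbers

variable {X : Type*} [MetricSpace X] [MeasurableSpace X] [BorelSpace X]
  [SecondCountableTopology X] {ω : Measure X} [SigmaFinite ω] {g : X → X → EReal} {V : X → EReal}
  {θ : X → ℝ} {γ l₀ : ℝ} {β : ℕ → ℝ}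

namespace IsAdmissible

theorem eventually_le_partitionFunction (h : IsAdmissible ω g V θ) {ρ : Measure X}
    [IsProbabilityMeasure ρ] {D : ℝ≥0} {L l : ℝ} (hρ : ρ ≤ D • ω) (hθ : Integrable θ ρ)
    (hL : 0 < L) (hdens : ρ = ω.withDensity fun x => ENNReal.ofReal L⁻¹ *
      EReal.exp (-(((γ * potential g ρ x : ℝ) : EReal) + V x)))
    (hβ : Tendsto (fun N : ℕ => β N * ((N + 1 : ℕ) : ℝ)) atTop (𝓝 γ))
    (hl : l < Real.log L + γ / 2 * ∫ x, potential g ρ x ∂ρ) :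
    ∀ᶠ N in atTop, ENNReal.ofReal (Real.exp (((N + 1 : ℕ) : ℝ) * l)) ≤
      partitionFunction (N + 1) ω (β N) g V := by
  set I := ∫ x, potential g ρ x ∂ρ with hI
  have hlim : Tendsto (fun N : ℕ => Real.log L + γ * I - β N * N / 2 * I) atTop
      (𝓝 (Real.log L + γ * I - γ / 2 * I)) :=
    (((tendsto_mul_of_tendsto_mul_succ hβ).div_const 2).mul_const I).const_sub _
  filter_upwards [hlim.eventually_const_le (u := l) (by linarith)] with N hN
  refine (ENNReal.ofReal_le_ofReal (Real.exp_le_exp.2 ?_)).trans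
    (h.le_partitionFunction hρ hθ hL hdens (N + 1) (β N))
  rw [← hI]
  calc ((N + 1 : ℕ) : ℝ) * l
      ≤ ((N + 1 : ℕ) : ℝ) * (Real.log L + γ * I - β N * N / 2 * I) := by gcongr
    _ = _ := by
      push_cast
      ring

theorem isAvoided_compl_of_mem_nhds [LocallyCompactSpace X] (h : IsAdmissible ω g V θ)
    (hγ : 0 ≤ γ) (hβ0 : ∀ N, 0 ≤ β N)
    (hβ : Tendsto (fun N : ℕ => β N * ((N + 1 : ℕ) : ℝ)) atTop (𝓝 γ))
    (hZ : ∀ l < l₀, ∀ᶠ N in atTop, ENNReal.ofReal (Real.exp (((N + 1 : ℕ) : ℝ) * l)) ≤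
      partitionFunction (N + 1) ω (β N) g V) {μ : ProbabilityMeasure X}
    (hlt : ∀ ρ ≠ μ, ENNReal.ofReal (Real.log
      (∫⁻ x, EReal.exp (-shiftedPotential V θ γ x) ∂ω).toReal - l₀) < freeEnergy ω g V θ γ ρ)
    {𝒰 : Set (ProbabilityMeasure X)} (h𝒰 : 𝒰 ∈ 𝓝 μ) :
    IsAvoided ω g V β 𝒰ᶜ := by
  obtain ⟨𝒦, h𝒦, havoid⟩ :=
    h.exists_isCompact_isAvoided_compl hγ hβ0 hβ (hZ (l₀ - 1) (sub_one_lt l₀))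
  have hcompact : IsAvoided ω g V β (𝒦 \ interior 𝒰) := by
    refine (h𝒦.diff isOpen_interior).induction_on .empty (fun _ _ hle hS => hS.mono hle)
      (fun _ _ hS hS' => hS.union hS') fun ρ hρ => ?_
    have hne : ρ ≠ μ := by
      rintro rfl
      exact hρ.2 (mem_interior_iff_mem_nhds.2 h𝒰)
    obtain ⟨r, -, hrlt, hrρ⟩ := ENNReal.lt_iff_exists_real_btwn.1 (hlt ρ hne)
    set C := ∫⁻ x, EReal.exp (-shiftedPotential V θ γ x) ∂ω
    have hl : Real.log C.toReal - r < l₀ := by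
      linarith [(ENNReal.ofReal_lt_ofReal_iff'.1 hrlt).1]
    obtain ⟨W, hW, hWavoid⟩ := h.exists_nhds_isAvoided hγ hβ0 hβ (hZ _ hl) (ρ := ρ)
      (by rwa [sub_sub_cancel])
    exact ⟨W, mem_nhdsWithin_of_mem_nhds hW, hWavoid⟩
  refine (havoid.union hcompact).mono fun ρ hρ => ?_
  by_cases hρ𝒦 : ρ ∈ 𝒦
  · exact Or.inr ⟨hρ𝒦, fun hint => hρ (interior_subset hint)⟩
  · exact Or.inl hρ𝒦

end IsAdmissible

end LawOfLargeNumbers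

section UniqueMinimizer

variable {X : Type*} [MeasurableSpace X] {ω : Measure X} {g : X → X → EReal} {V : X → EReal}
  {θ : X → ℝ} {γ : ℝ}

/-- Otherwise the reference measure would be zero, so that every probability measure would have
infinite free energy and be a minimizer. -/
theorem lintegral_exp_neg_potential_ne_zero [MeasurableSingletonClass X] [Nontrivial X]
    (hV : Measurable V) {μ : ProbabilityMeasure X}
    (huniq : ∀ ν : ProbabilityMeasure X, (∀ ν' : ProbabilityMeasure X,
      freeEnergy ω g V θ γ ν ≤ freeEnergy ω g V θ γ ν') → ν = μ) :
    ∫⁻ x, EReal.exp (-V x) ∂ω ≠ 0 := by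
  intro hzero
  have hdens : (fun x => EReal.exp (-shiftedPotential V θ γ x)) =ᵐ[ω] 0 := by
    filter_upwards [(lintegral_eq_zero_iff hV.neg.ereal_exp).1 hzero] with x hx
    rw [exp_neg_shiftedPotential]
    simp_all
  have href : referenceMeasure ω V θ γ = 0 := by
    rw [referenceMeasure, withDensity_congr_ae hdens, withDensity_zero, smul_zero]
  have htop (ν : ProbabilityMeasure X) : freeEnergy ω g V θ γ ν = ∞ := by
    rw [freeEnergy, href, klDiv_zero_right, add_top]
  have heq (ν : ProbabilityMeasure X) : ν = μ := huniq ν fun ν' => by rw [htop, htop]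
  obtain ⟨x, y, hxy⟩ := exists_pair_ne X
  exact hxy (dirac_eq_dirac_iff.1 (congrArg (fun ν : ProbabilityMeasure X => (ν : Measure X))
    ((heq ⟨Measure.dirac x, inferInstance⟩).trans (heq ⟨Measure.dirac y, inferInstance⟩).symm)))

end UniqueMinimizer

section Manifold

theorem sigmaFinite_sum_restrict {X : Type*} [MeasurableSpace X] (μ : ℕ → Measure X)
    [∀ i, SigmaFinite (μ i)] {D : ℕ → Set X} (hD : ∀ i, MeasurableSet (D i))
    (hdisj : Pairwise (Function.onFun Disjoint D)) (hcov : ⋃ i, D i = Set.univ) :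
    SigmaFinite (Measure.sum fun i => (μ i).restrict (D i)) := by
  set T : ℕ × ℕ → Set X := fun p => D p.1 ∩ spanningSets (μ p.1) p.2
  have hT (p : ℕ × ℕ) : MeasurableSet (T p) :=
    (hD p.1).inter (measurableSet_spanningSets (μ p.1) p.2)
  refine Measure.sigmaFinite_of_countable (Set.countable_range T) ?_ ?_
  · rintro _ ⟨⟨i, k⟩, rfl⟩
    have hother : ∀ j ≠ i, (μ j).restrict (D j) (T (i, k)) = 0 := fun j hj => by
      rw [Measure.restrict_apply (hT (i, k)),
        ((hdisj hj.symm).mono_left Set.inter_subset_left).inter_eq, measure_empty]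
    rw [Measure.sum_apply _ (hT (i, k)), tsum_eq_single i hother]
    calc (μ i).restrict (D i) (T (i, k)) ≤ μ i (T (i, k)) := Measure.restrict_apply_le _ _
      _ ≤ μ i (spanningSets (μ i) k) := measure_mono Set.inter_subset_right
      _ < ∞ := measure_spanningSets_lt_top _ _
  · refine Set.eq_univ_of_forall fun x => ?_
    obtain ⟨i, hi⟩ := Set.mem_iUnion.1 (hcov.symm ▸ Set.mem_univ x)
    exact ⟨_, ⟨(i, _), rfl⟩, hi, mem_spanningSetsIndex (μ i) x⟩

theorem sigmaFinite_map_symm {M H : Type*} [TopologicalSpace M] [MeasurableSpace M]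
    [BorelSpace M] [TopologicalSpace H] [MeasurableSpace H] [BorelSpace H]
    (e : OpenPartialHomeomorph M H) {m : Measure H} [SigmaFinite m] (hm : m e.targetᶜ = 0) :
    SigmaFinite (m.map e.symm) := by
  have htarget : ∀ᵐ y ∂m, y ∈ e.target := mem_ae_iff.2 hm
  have hsymm : AEMeasurable e.symm m := by
    rw [← Measure.restrict_eq_self_of_ae_mem htarget]
    exact e.continuousOn_symm.aemeasurable e.open_target.measurableSet
  have hsource : ∀ᵐ x ∂m.map e.symm, x ∈ e.source :=
    (mem_ae_map_iff hsymm e.open_source.measurableSet).2 (htarget.mono fun _ => e.map_target)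
  have he : AEMeasurable e (m.map e.symm) := by
    rw [← Measure.restrict_eq_self_of_ae_mem hsource]
    exact e.continuousOn.aemeasurable e.open_source.measurableSet
  have hid : e ∘ e.symm =ᵐ[m] id := htarget.mono fun _ => e.right_inv
  refine .of_map _ he ?_
  rwa [AEMeasurable.map_map_of_aemeasurable he hsymm, Measure.map_congr hid, Measure.map_id]

theorem nontrivial_of_chartedSpace (H M : Type*) [TopologicalSpace H] [∀ y : H, (𝓝[≠] y).NeBot]
    [TopologicalSpace M] [ChartedSpace H M] [Nonempty M] : Nontrivial M := by
  by_contra hM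
  rw [not_nontrivial_iff_subsingleton] at hM
  obtain ⟨x⟩ := ‹Nonempty M›
  set e := chartAt H x
  have htarget : e.target = {e x} :=
    Set.eq_singleton_iff_unique_mem.2 ⟨e.map_source (mem_chart_source H x), fun y hy => by
      rw [← e.right_inv hy, Subsingleton.elim (e.symm y) x]⟩
  exact not_isOpen_singleton (e x) (htarget ▸ e.open_target)

instance sigmaFinite_riemannianVolume {n : ℕ} {M : Type*} [MetricSpace M]
    [ChartedSpace (EuclideanSpace ℝ (Fin n)) M] [Nonempty M] [SecondCountableTopology M]
    [MeasurableSpace M] [BorelSpace M] [RiemannianBundle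
      (fun x : M => TangentSpace (modelWithCornersSelf ℝ (EuclideanSpace ℝ (Fin n))) x)] :
    SigmaFinite (riemannianVolume n M) := by
  have hchart (i : ℕ) : SigmaFinite
      (chartVolume (chartAt (EuclideanSpace ℝ (Fin n)) (chartCenter n M i))) := by
    refine sigmaFinite_map_symm _ (withDensity_absolutelyContinuous _ _ ?_)
    rw [Measure.restrict_apply (OpenPartialHomeomorph.open_target _).measurableSet.compl,
      Set.compl_inter_self, measure_empty]
  refine sigmaFinite_sum_restrict _ (fun i => .disjointed (fun j =>
    (OpenPartialHomeomorph.open_source _).measurableSet) i) (disjoint_disjointed _) ?_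
  rw [iUnion_disjointed]
  exact (exists_countable_chart_cover n M).choose_spec

end Manifold

section Theorem

theorem mainTheorem9_general {X : Type*} [MetricSpace X] [SecondCountableTopology X]
    [LocallyCompactSpace X] [MeasurableSpace X] [BorelSpace X] {ω : Measure X} [SigmaFinite ω]
    {g : X → X → EReal} {V : X → EReal} {θ : X → ℝ} (h : IsAdmissible ω g V θ)
    {γ : ℝ} (hγ : 0 ≤ γ) {μ : ProbabilityMeasure X}
    (hmin : ∀ ν : ProbabilityMeasure X, freeEnergy ω g V θ γ μ ≤ freeEnergy ω g V θ γ ν)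
    (huniq : ∀ ν : ProbabilityMeasure X, (∀ ν' : ProbabilityMeasure X,
      freeEnergy ω g V θ γ ν ≤ freeEnergy ω g V θ γ ν') → ν = μ) :
    (∀ β : ℕ → ℝ, (∀ N, 0 ≤ β N) → Tendsto (fun N : ℕ => β N * N) atTop (𝓝 γ) →
      (∀ N : ℕ, IsProbabilityMeasure (gibbsMeasure (N + 1) ω (β (N + 1)) g V)) ∧
      ∀ 𝒰 ∈ 𝓝 μ, Tendsto (fun N : ℕ => gibbsMeasure (N + 1) ω (β (N + 1)) g V
        {x | empiricalMeasure x ∉ 𝒰}) atTop (𝓝 0)) ∧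
    (∀ x, (∀ᵐ z ∂(μ : Measure X), g x z ≠ ⊤) ∧
      Integrable (fun z => (g x z).toReal) (μ : Measure X)) ∧
    Continuous (potential g (μ : Measure X)) ∧
    ∃ L : ℝ, 0 < L ∧ (μ : Measure X) = ω.withDensity fun x => ENNReal.ofReal L⁻¹ *
      EReal.exp (-(((γ * potential g (μ : Measure X) x : ℝ) : EReal) + V x)) := by
  obtain ⟨D, hD⟩ := h.exists_minimizer_le_smul hγ hmin
  have hθ := h.integrable_theta_minimizer hγ hmin
  obtain ⟨L, hL, hdens, hF⟩ := h.exists_minimizer_eq_withDensity hγ hmin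
  refine ⟨fun β hβ0 hβ => ?_, fun x => ⟨h.ae_kernel_ne_top hD hθ x, h.integrable_kernel hD hθ x⟩,
    h.continuous_potential hD hθ, L, hL, hdens⟩
  have hβ' := hβ.comp (tendsto_add_atTop_nat 1)
  refine ⟨fun N => h.isProbabilityMeasure_gibbsMeasure (hβ0 _) ((ENNReal.ofReal_pos.2
    (Real.exp_pos _)).trans_le (h.le_partitionFunction hD hθ hL hdens _ _)).ne', fun 𝒰 h𝒰 => ?_⟩
  refine h.isAvoided_compl_of_mem_nhds (β := fun N => β (N + 1)) hγ (fun N => hβ0 _) hβ'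
    (fun l hl => h.eventually_le_partitionFunction hD hθ hL hdens hβ' hl) (fun ρ hρ => ?_) h𝒰
  rw [← sub_sub, ← hF]
  exact lt_of_not_ge fun hle => hρ (huniq ρ fun ν => hle.trans (hmin ν))

end Theorem

end GibbsGas

end

open GibbsGas in
theorem mainTheorem9 {n : ℕ} [NeZero n]
    {M : Type*} [MetricSpace M] [ConnectedSpace M] [SecondCountableTopology M]
    [MeasurableSpace M] [BorelSpace M]
    [ChartedSpace (EuclideanSpace ℝ (Fin n)) M]
    [IsManifold (modelWithCornersSelf ℝ (EuclideanSpace ℝ (Fin n))) ((⊤ : ℕ∞) : WithTop ℕ∞) M]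
    [RiemannianBundle
      (fun x : M => TangentSpace (modelWithCornersSelf ℝ (EuclideanSpace ℝ (Fin n))) x)]
    [IsContMDiffRiemannianBundle (modelWithCornersSelf ℝ (EuclideanSpace ℝ (Fin n)))
      ((⊤ : ℕ∞) : WithTop ℕ∞) (EuclideanSpace ℝ (Fin n))
      (fun x : M => TangentSpace (modelWithCornersSelf ℝ (EuclideanSpace ℝ (Fin n))) x)]
    [IsRiemannianManifold (modelWithCornersSelf ℝ (EuclideanSpace ℝ (Fin n))) M]
    (g : M → M → EReal) (V : M → EReal) (θ : M → ℝ)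
    (hass : Assumptions n (riemannianVolume n M) g V θ)
    (γ : ℝ) (hγ : 0 ≤ γ) (μ : ProbabilityMeasure M)
    (hmin : ∀ ν : ProbabilityMeasure M,
      freeEnergy (riemannianVolume n M) g V θ γ μ ≤ freeEnergy (riemannianVolume n M) g V θ γ ν)
    (huniq : ∀ ν : ProbabilityMeasure M,
      (∀ ν' : ProbabilityMeasure M, freeEnergy (riemannianVolume n M) g V θ γ ν ≤
        freeEnergy (riemannianVolume n M) g V θ γ ν') → ν = μ) :
    (∀ β : ℕ → ℝ, (∀ N, 0 < β N) → Tendsto (fun N : ℕ => β N * N) atTop (𝓝 γ) →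
      (∀ N : ℕ, IsProbabilityMeasure
        (gibbsMeasure (N + 1) (riemannianVolume n M) (β (N + 1)) g V)) ∧
      ∀ 𝒰 ∈ 𝓝 μ, Tendsto
        (fun N : ℕ => gibbsMeasure (N + 1) (riemannianVolume n M) (β (N + 1)) g V
          {x | empiricalMeasure x ∉ 𝒰}) atTop (𝓝 0)) ∧
    (∀ x, (∀ᵐ z ∂(μ : Measure M), g x z ≠ ⊤) ∧
      Integrable (fun z => (g x z).toReal) (μ : Measure M)) ∧
    Continuous (potential g (μ : Measure M)) ∧
    ∃ L : ℝ, 0 < L ∧ (μ : Measure M) = (riemannianVolume n M).withDensity fun x =>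
      ENNReal.ofReal L⁻¹ *
        EReal.exp (-(((γ * potential g (μ : Measure M) x : ℝ) : EReal) + V x)) := by
  have : LocallyCompactSpace M := ChartedSpace.locallyCompactSpace (EuclideanSpace ℝ (Fin n)) M
  have := nontrivial_of_chartedSpace (EuclideanSpace ℝ (Fin n)) M
  obtain ⟨hlln, hpot⟩ := mainTheorem9_general (hass.isAdmissible
    (lintegral_exp_neg_potential_ne_zero hass.measurable_potential huniq)) hγ hmin huniq
  exact ⟨fun β hβ => hlln β fun N => (hβ N).le, hpot⟩
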